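/- **The walk.** For $M\ge 1$, the $M$-coin Hadamard walk lives on $\ell^2(\mathbb Z)\otimes(\mathbb C^2)^{\otimes M}$ with basis vectors $|x,\xi_{M-1},\dots,\xi_0\rangle$, $x\in\mathbb Z$, $\xi_j\in\{1,-1\}$, where $|1\rangle={}^T[1,0]$, $|{-1}\rangle={}^T[0,1]$. The step from time $s$ to time $s+1$ is as follows: with $j=s \bmod M$, first the Hadamard matrix $H=\frac1{\sqrt2}\begin{bmatrix}1&1\\1&-1\end{bmatrix}$ acts on the $j$-th coin, then $|x,\xi\rangle$ is sent to $|x+\xi_j,\xi\rangle$. The walk starts at $x=0$ with an initial qubit (unit coin state) $\Phi_0$; if $\Phi_t(x)$ denotes the coin state at position $x$ and time $t$, the position $X_t=X_t^{[M]}$ has law $P(X_t=x)=\|\Phi_t(x)\|^2$, averaged over $\Phi_0$ when $\Phi_0$ is random. Put $\varphi_0={}^T[1/\sqrt2,\,i/\sqrt2]$. **The limits.** Let $\mathcal X\sim N(0,1)$, $\mathcal Z$ with density $\rho(x)=\dfrac{\mathbf 1_{(-1/\sqrt2,1/\sqrt2)}(x)}{\pi(1-x^2)\sqrt{1-2x^2}}$,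 and $\mathcal W^{(\beta)}$ with density $2^\beta s(2^\beta x)$, where $s(x)=\dfrac{\mathbf 1_{(-1,1)}(x)}{\pi\sqrt{1-x^2}}$, be independent; $\Rightarrow$ is weak convergence. Let $(\beta,\theta)\in[0,1]^2$. **Theorem.** 1. Let $M\to\infty$, let $m=m(M)$ be integers with $0\le m\le M$ and $m/M^\beta\to1$ (for instance $m=\lfloor M^\beta\rfloor$), let $t=M+m$, and let the initial qubit be $\varphi_0^{\otimes M}$. Then $$X_t/t^\theta\Rightarrow\begin{cases}\delta_0&\text{if }\theta>\max\{1/2,\beta\},\\ \mathcal X&\text{if }\theta=1/2,\ 0\le\beta<1/2,\\ \mathcal X+\mathcal W^{(0)}&\text{if }\theta=\beta=1/2,\\ \mathcal W^{(0)}&\text{if }1/2<\theta=\beta<1,\\ \mathcal W^{(1)}&\text{if }\theta=\beta=1.\end{cases}$$ 2. Let $M\to\infty$, let $m$ be as in 1, let $t=2M$, and let the initial qubit be $\varphi_0^{\otimes m}\otimes\phi_1\otimes\cdots\otimes\phi_{M-m}$ with $\phi_1,\dots,\phi_{M-m}$ i.i.d., equal to $|1\rangle$ or $|{-1}\rangle$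 with probability $1/2$ each. Then $$X_t/t^\theta\Rightarrow\begin{cases}\delta_0&\text{if }\theta>\max\{1/2,\beta\},\\ \mathcal X&\text{if }\theta=1/2,\ 0\le\beta<1/2,\\ \mathcal X+\mathcal W^{(1/2)}&\text{if }\theta=\beta=1/2,\\ \mathcal W^{(\beta)}&\text{if }1/2<\theta=\beta\le1.\end{cases}$$ 3. Let $t\to\infty$, with $M\ge1$ depending on $t$ such that $M/t^{1-\beta}\to1$ and $d/t^\beta\to1$, where $d=\lfloor t/M\rfloor$, and let the initial qubit be $\phi_{M-1}\otimes\cdots\otimes\phi_0$ with $\phi_0,\dots,\phi_{M-1}$ i.i.d., equal to $|1\rangle$ or $|{-1}\rangle$ with probability $1/2$ each. Then $$X_t/t^\theta\Rightarrow\begin{cases}\delta_0&\text{if }\theta>(1+\beta)/2,\\ \mathcal X&\text{if }\theta=1/2,\ \beta=0,\\ \mathcal X\mathcal Z&\text{if }\theta=(1+\beta)/2,\ 0<\beta<1,\\ \mathcal Z&\text{if }\theta=\beta=1.\end{cases}$$ -/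

import Mathlib

open MeasureTheory ProbabilityTheory Filter Topology Set

noncomputable section

namespace ManyCoins

/-! ### The many-coin Hadamard walk -/

/-- The displacement of a chirality: index `0` is the basis vector `|1⟩ = ᵀ[1,0]` and index `1` is
the basis vector `|-1⟩ = ᵀ[0,1]`. -/
def chirality : Fin 2 → ℤ := ![1, -1]

/-- The two-dimensional Hadamard matrix. -/
def hadamard : Matrix (Fin 2) (Fin 2) ℂ :=
  (((Real.sqrt 2 : ℝ) : ℂ)⁻¹) • !![1, 1; 1, -1]

/-- Joint amplitudes of position and `M` coins, in the standard basis
`|x, ξ_{M-1}, …, ξ_0⟩` of `ℋ_P ⊗ (ℂ²)^{⊗ M}`. -/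
abbrev State (M : ℕ) : Type := ℤ → (Fin M → Fin 2) → ℂ

/-- The coin flip: the Hadamard matrix acts on the `j`-th coin. -/
def coinFlip {M : ℕ} (j : Fin M) (Ψ : State M) : State M :=
  fun x ξ => ∑ η : Fin 2, hadamard (ξ j) η * Ψ x (Function.update ξ j η)

/-- The shift: the basis vector `|x, ξ⟩` is sent to `|x + ξ_j, ξ⟩`. -/
def shift {M : ℕ} (j : Fin M) (Ψ : State M) : State M :=
  fun x ξ => Ψ (x - chirality (ξ j)) ξ

/-- The evolution `Φ_t`: it starts from `Ψ`, and the step from time `t` to time `t + 1` is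
`S · C` with the coin number `t mod M`. -/
def evolve {M : ℕ} [NeZero M] (Ψ : State M) : ℕ → State M
  | 0 => Ψ
  | t + 1 => shift (Fin.ofNat M t) (coinFlip (Fin.ofNat M t) (evolve Ψ t))

/-- Unit vectors of `ℂ²`. -/
abbrev Qubit : Type := {v : EuclideanSpace ℂ (Fin 2) // ‖v‖ = 1}

/-- The particle is at the origin, and the coin state is the product
`φ_{M-1} ⊗ ⋯ ⊗ φ_0`. -/
def initState {M : ℕ} (φ : Fin M → Qubit) : State M :=
  fun x ξ => if x = 0 then ∏ j, (φ j).1 (ξ j) else 0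

/-- `‖Ψ(x)‖²`, the squared norm of the coin state at the position `x`. -/
def posWeight {M : ℕ} (Ψ : State M) (x : ℤ) : ℝ := ∑ ξ : Fin M → Fin 2, ‖Ψ x ξ‖ ^ 2

theorem posWeight_nonneg {M : ℕ} (Ψ : State M) (x : ℤ) : 0 ≤ posWeight Ψ x :=
  Finset.sum_nonneg fun _ _ => by positivity

theorem hadamard_norm (u v : ℂ) :
    ‖hadamard 0 0 * u + hadamard 0 1 * v‖ ^ 2 + ‖hadamard 1 0 * u + hadamard 1 1 * v‖ ^ 2
      = ‖u‖ ^ 2 + ‖v‖ ^ 2 := by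
  have h2 : (Real.sqrt 2)⁻¹ ^ 2 = (1 / 2 : ℝ) := by
    rw [inv_pow, Real.sq_sqrt (by norm_num)]; norm_num
  have e : ∀ z : ℂ, ‖(((Real.sqrt 2 : ℝ) : ℂ)⁻¹) * z‖ ^ 2 = 1 / 2 * ‖z‖ ^ 2 := by
    intro z
    rw [norm_mul, mul_pow, norm_inv, Complex.norm_real, Real.norm_of_nonneg (Real.sqrt_nonneg 2),
      h2]
  have h1 : hadamard 0 0 * u + hadamard 0 1 * v = (((Real.sqrt 2 : ℝ) : ℂ)⁻¹) * (u + v) := by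
    simp [hadamard]; ring
  have h3 : hadamard 1 0 * u + hadamard 1 1 * v = (((Real.sqrt 2 : ℝ) : ℂ)⁻¹) * (u - v) := by
    simp [hadamard]; ring
  rw [h1, h3, e, e]
  have := parallelogram_law_with_norm ℝ u v
  nlinarith

theorem posWeight_coinFlip {M : ℕ} (j : Fin M) (Ψ : State M) (x : ℤ) :
    posWeight (coinFlip j Ψ) x = posWeight Ψ x := by
  have inv : Function.Involutive
      (fun ξ : Fin M → Fin 2 => Function.update ξ j (1 - ξ j)) := by
    intro ξ
    simp
  have key : ∀ g : (Fin M → Fin 2) → ℝ,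
      2 * ∑ ξ, g ξ = ∑ ξ, (g ξ + g (Function.update ξ j (1 - ξ j))) := by
    intro g
    rw [Finset.sum_add_distrib, two_mul]
    congr 1
    exact (Equiv.sum_comp inv.toPerm g).symm
  have h : 2 * posWeight (coinFlip j Ψ) x = 2 * posWeight Ψ x := by
    unfold posWeight
    rw [key, key]
    refine Finset.sum_congr rfl fun ξ _ => ?_
    have hb : ξ j = 0 ∨ ξ j = 1 := by omega
    rcases hb with hb | hb
    · have e0 : Function.update ξ j 0 = ξ := by rw [← hb]; simp
      have := hadamard_norm (Ψ x ξ) (Ψ x (Function.update ξ j 1))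
      simpa [coinFlip, Fin.sum_univ_two, hb, e0] using this
    · have e0 : Function.update ξ j 1 = ξ := by rw [← hb]; simp
      have := hadamard_norm (Ψ x (Function.update ξ j 0)) (Ψ x ξ)
      simp only [coinFlip, Fin.sum_univ_two, hb, e0, Function.update_self,
        Function.update_idem, sub_self]
      linarith
  linarith

/-- Total probability as a sum of extended nonnegative reals. -/
def totalWeight {M : ℕ} (Ψ : State M) : ENNReal := ∑' x, ENNReal.ofReal (posWeight Ψ x)

theorem totalWeight_shift {M : ℕ} (j : Fin M) (Ψ : State M) :
    totalWeight (shift j Ψ) = totalWeight Ψ := by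
  have h : ∀ Ψ : State M,
      totalWeight Ψ = ∑ ξ : Fin M → Fin 2, ∑' x, ENNReal.ofReal (‖Ψ x ξ‖ ^ 2) := by
    intro Ψ
    unfold totalWeight posWeight
    rw [← Summable.tsum_finsetSum (fun _ _ => ENNReal.summable)]
    refine tsum_congr fun x => ?_
    exact ENNReal.ofReal_sum_of_nonneg fun _ _ => by positivity
  rw [h, h]
  refine Finset.sum_congr rfl fun ξ _ => ?_
  exact (Equiv.subRight (chirality (ξ j))).tsum_eq (fun x => ENNReal.ofReal (‖Ψ x ξ‖ ^ 2))

theorem totalWeight_initState {M : ℕ} (φ : Fin M → Qubit) : totalWeight (initState φ) = 1 := by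
  unfold totalWeight
  rw [tsum_eq_single 0]
  · have : posWeight (initState φ) 0 = 1 := by
      have h1 : ∀ j, ∑ b : Fin 2, ‖(φ j).1 b‖ ^ 2 = 1 := by
        intro j
        rw [← EuclideanSpace.norm_sq_eq, (φ j).2, one_pow]
      have h2 := Finset.prod_univ_sum (fun _ : Fin M => (Finset.univ : Finset (Fin 2)))
        (fun j b => ‖(φ j).1 b‖ ^ 2)
      simp only [h1, Finset.prod_const_one, Fintype.piFinset_univ] at h2
      simp only [posWeight, initState, if_true, norm_prod, ← Finset.prod_pow]
      exact h2.symm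
    rw [this, ENNReal.ofReal_one]
  · intro x hx
    simp [posWeight, initState, hx]

theorem totalWeight_evolve {M : ℕ} [NeZero M] (φ : Fin M → Qubit) (t : ℕ) :
    totalWeight (evolve (initState φ) t) = 1 := by
  induction t with
  | zero => exact totalWeight_initState φ
  | succ t ih =>
    rw [evolve, totalWeight_shift, ← ih]
    unfold totalWeight
    simp only [posWeight_coinFlip]

/-- The law of the position `X_t` of the `M`-coin walk started from the pure product qubit
`φ_{M-1} ⊗ ⋯ ⊗ φ_0`: the probability of `x` is `‖Φ_t(x)‖²`. -/
def positionLaw {M : ℕ} [NeZero M] (φ : Fin M → Qubit) (t : ℕ) : PMF ℤ :=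
  ⟨fun x => ENNReal.ofReal (posWeight (evolve (initState φ) t) x), by
    have h := (totalWeight_evolve φ t)
    unfold totalWeight at h
    rw [← h]
    exact ENNReal.summable.hasSum⟩

/-! ### Initial qubits -/

/-- The basis qubit `|1⟩` (`b = 0`) or `|-1⟩` (`b = 1`). -/
def ket (b : Fin 2) : Qubit := ⟨EuclideanSpace.single b 1, by simp⟩

/-- The qubit `φ₀ = ᵀ[1/√2, i/√2]`. -/
def symQubit : Qubit :=
  ⟨!₂[1 / ((Real.sqrt 2 : ℝ) : ℂ), Complex.I / ((Real.sqrt 2 : ℝ) : ℂ)], by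
    rw [EuclideanSpace.norm_eq]
    simp [Fin.sum_univ_two]
    norm_num⟩

/-- The law of `X_t` for the initial qubit `φ₀^{⊗ M}`. -/
def pureLaw (M : ℕ) [NeZero M] (t : ℕ) : PMF ℤ := positionLaw (fun _ : Fin M => symQubit) t

/-- The law of `X_t` for the initial qubit `φ_{M-1} ⊗ ⋯ ⊗ φ_0`, where the `φ_j` are independent
and uniform on `{|1⟩, |-1⟩}`. -/
def randomLaw (M : ℕ) [NeZero M] (t : ℕ) : PMF ℤ :=
  (PMF.uniformOfFintype (Fin M → Fin 2)).bind fun b => positionLaw (fun j => ket (b j)) t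

/-- The law of `X_t` for the initial qubit `φ₀^{⊗ m} ⊗ φ_1 ⊗ ⋯ ⊗ φ_{M-m}`, where the `φ_i` are
independent and uniform on `{|1⟩, |-1⟩}`. The first `m` tensor factors belong to the coins with
the `m` largest indices (the bits `b j` of these coins are not used). -/
def mixedLaw (M m : ℕ) [NeZero M] (t : ℕ) : PMF ℤ :=
  (PMF.uniformOfFintype (Fin M → Fin 2)).bind fun b =>
    positionLaw (fun j => if M ≤ (j : ℕ) + m then symQubit else ket (b j)) t

/-- The law of `X / t ^ θ` on the real line, when `X` has law `p`. -/
def rescaled (p : PMF ℤ) (t : ℕ) (θ : ℝ) : ProbabilityMeasure ℝ :=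
  ⟨p.toMeasure.map (fun x : ℤ => (x : ℝ) / (t : ℝ) ^ θ),
    Measure.isProbabilityMeasure_map (measurable_of_countable _).aemeasurable⟩

/-! ### The limit laws -/

theorem lintegral_indicator_deriv {a b : ℝ} (hab : a ≤ b) {F g : ℝ → ℝ}
    (hF : ContinuousOn F (Icc a b)) (hd : ∀ x ∈ Ioo a b, HasDerivAt F (g x) x)
    (hg : ∀ x ∈ Ioo a b, 0 ≤ g x) (h1 : F b - F a = 1) :
    ∫⁻ x, ENNReal.ofReal ((Ioo a b).indicator g x) = 1 := by
  have hi : IntegrableOn g (Ioc a b) := intervalIntegral.integrableOn_deriv_of_nonneg hF hd hg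
  have hI : ∫ x in a..b, g x = 1 := by
    rw [intervalIntegral.integral_eq_sub_of_hasDerivAt_of_le hab hF hd
      ((intervalIntegrable_iff_integrableOn_Ioc_of_le hab).2 hi), h1]
  have hi' : IntegrableOn g (Ioo a b) := hi.mono_set Ioo_subset_Ioc_self
  rw [← ofReal_integral_eq_lintegral_ofReal]
  · rw [integral_indicator measurableSet_Ioo, ← integral_Ioc_eq_integral_Ioo,
      ← intervalIntegral.integral_of_le hab, hI, ENNReal.ofReal_one]
  · exact (integrable_indicator_iff measurableSet_Ioo).2 hi'
  · exact Eventually.of_forall fun x => indicator_nonneg hg x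

/-- The density of the arcsine law. -/
def arcsineDensity (x : ℝ) : ℝ :=
  (Ioo (-1 : ℝ) 1).indicator (fun x => 1 / (Real.pi * Real.sqrt (1 - x ^ 2))) x

/-- The density of the limit law of the symmetric Hadamard walk. -/
def konnoDensity (x : ℝ) : ℝ :=
  (Ioo (-(1 / Real.sqrt 2)) (1 / Real.sqrt 2)).indicator
    (fun x => 1 / (Real.pi * (1 - x ^ 2) * Real.sqrt (1 - 2 * x ^ 2))) x

theorem lintegral_arcsineDensity {c : ℝ} (hc : 0 < c) :
    ∫⁻ x, ENNReal.ofReal (c * arcsineDensity (c * x)) = 1 := by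
  have e : ∀ x, c * arcsineDensity (c * x) = (Ioo (-c⁻¹) c⁻¹).indicator
      (fun x => c / (Real.pi * Real.sqrt (1 - (c * x) ^ 2))) x := by
    intro x
    have hm : c * x ∈ Ioo (-1 : ℝ) 1 ↔ x ∈ Ioo (-c⁻¹) c⁻¹ := by
      have h1 : c * (-c⁻¹) = -1 := by field_simp
      have h2 : c * c⁻¹ = 1 := by field_simp
      simp only [mem_Ioo]
      rw [← mul_lt_mul_iff_right₀ hc (b := -c⁻¹), ← mul_lt_mul_iff_right₀ hc (c := c⁻¹), h1, h2]
    unfold arcsineDensity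
    by_cases hx : x ∈ Ioo (-c⁻¹) c⁻¹
    · rw [indicator_of_mem hx, indicator_of_mem (hm.2 hx)]; ring
    · rw [indicator_of_notMem hx, indicator_of_notMem (fun h => hx (hm.1 h)), mul_zero]
  simp only [e]
  have hc' : (0 : ℝ) < c⁻¹ := by positivity
  refine lintegral_indicator_deriv (F := fun x => Real.arcsin (c * x) / Real.pi)
    (by linarith) (by fun_prop) ?_ ?_ ?_
  · intro x hx
    have h1 : c * x < 1 := by
      have := mul_lt_mul_of_pos_left hx.2 hc
      rwa [mul_inv_cancel₀ hc.ne'] at this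
    have h2 : -1 < c * x := by
      have := mul_lt_mul_of_pos_left hx.1 hc
      rwa [mul_neg, mul_inv_cancel₀ hc.ne'] at this
    have := ((Real.hasDerivAt_arcsin h2.ne' h1.ne).comp x
      ((hasDerivAt_id x).const_mul c)).div_const Real.pi
    refine this.congr_deriv ?_
    simp only [mul_one]
    field_simp
  · intro x _
    have := Real.pi_pos
    positivity
  · have hp := Real.pi_ne_zero
    simp only [mul_neg, mul_inv_cancel₀ hc.ne', Real.arcsin_one, Real.arcsin_neg]
    field_simp
    norm_num

theorem lintegral_konnoDensity : ∫⁻ x, ENNReal.ofReal (konnoDensity x) = 1 := by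
  have hs : (0 : ℝ) < Real.sqrt 2 := by positivity
  have hsq : (1 / Real.sqrt 2) ^ 2 = (1 / 2 : ℝ) := by
    rw [div_pow, Real.sq_sqrt (by norm_num)]; norm_num
  have hpos : (0 : ℝ) < 1 / Real.sqrt 2 := by positivity
  unfold konnoDensity
  refine lintegral_indicator_deriv
    (F := fun x => Real.arcsin (x / Real.sqrt (1 - x ^ 2)) / Real.pi) (by linarith) ?_ ?_ ?_ ?_
  · refine ContinuousOn.div_const (Real.continuous_arcsin.comp_continuousOn ?_) _
    refine ContinuousOn.div (by fun_prop) (by fun_prop) fun x hx => ?_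
    have : x ^ 2 ≤ 1 / 2 := by rw [← hsq]; exact sq_le_sq' hx.1 hx.2
    exact (Real.sqrt_pos.2 (by linarith)).ne'
  · intro x hx
    have hx2 : x ^ 2 < 1 / 2 := by rw [← hsq]; exact sq_lt_sq' hx.1 hx.2
    set r := Real.sqrt (1 - x ^ 2) with hr
    have hr0 : 0 < r := Real.sqrt_pos.2 (by linarith)
    have hrr : r ^ 2 = 1 - x ^ 2 := Real.sq_sqrt (by linarith)
    have hw0 : 0 < Real.sqrt (1 - 2 * x ^ 2) := Real.sqrt_pos.2 (by linarith)
    have hlt : (x / r) ^ 2 < 1 := by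
      rw [div_pow, hrr, div_lt_one (by linarith)]; linarith
    have hab : |x / r| < 1 := (sq_lt_one_iff_abs_lt_one _).1 hlt
    have hq : Real.sqrt (1 - (x / r) ^ 2) = Real.sqrt (1 - 2 * x ^ 2) / r := by
      have : 1 - (x / r) ^ 2 = (1 - 2 * x ^ 2) / r ^ 2 := by
        have h3 : r ^ 2 = 1 - x ^ 2 := hrr
        field_simp
        linarith
      rw [this, Real.sqrt_div (by linarith), Real.sqrt_sq hr0.le]
    have hd0 : HasDerivAt (fun y : ℝ => 1 - y ^ 2) (-(2 * x)) x := by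
      have := ((hasDerivAt_id x).pow 2).const_sub 1
      refine this.congr_deriv ?_
      simp
    have hd1 := hd0.sqrt (show 1 - x ^ 2 ≠ 0 by linarith)
    have hd2 := (hasDerivAt_id x).div hd1 hr0.ne'
    have hd3 := ((Real.hasDerivAt_arcsin (abs_lt.1 hab).1.ne' (abs_lt.1 hab).2.ne).comp x
      hd2).div_const Real.pi
    refine hd3.congr_deriv ?_
    simp only [id]
    rw [← hr, hq, ← hrr]
    have hp := Real.pi_pos
    field_simp
    linarith
  · intro x hx
    have hx2 : x ^ 2 < 1 / 2 := by rw [← hsq]; exact sq_lt_sq' hx.1 hx.2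
    have := Real.pi_pos
    have : 0 < 1 - x ^ 2 := by linarith
    positivity
  · have hp := Real.pi_ne_zero
    have h1 : (1 / Real.sqrt 2) / Real.sqrt (1 - (1 / Real.sqrt 2) ^ 2) = 1 := by
      rw [hsq, show (1 - 1 / 2 : ℝ) = 1 / 2 by norm_num, Real.sqrt_div (by norm_num),
        Real.sqrt_one]
      exact div_self hpos.ne'
    simp only [neg_sq, neg_div, Real.arcsin_neg, h1, Real.arcsin_one]
    field_simp
    norm_num

/-- The point mass at `0`. -/
def pointMass : ProbabilityMeasure ℝ := ⟨Measure.dirac 0, inferInstance⟩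

/-- The law `N(0,1)`. -/
def stdNormal : ProbabilityMeasure ℝ := ⟨gaussianReal 0 1, inferInstance⟩

/-- The scaled arcsine law `F^(β)`, with density `2^β s(2^β x)`. -/
def arcsineLaw (β : ℝ) : ProbabilityMeasure ℝ :=
  ⟨volume.withDensity fun x => ENNReal.ofReal ((2 : ℝ) ^ β * arcsineDensity ((2 : ℝ) ^ β * x)),
    ⟨by rw [withDensity_apply _ MeasurableSet.univ, Measure.restrict_univ,
          lintegral_arcsineDensity (by positivity)]⟩⟩

/-- The law `K`, with density `ρ`. -/
def konnoLaw : ProbabilityMeasure ℝ :=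
  ⟨volume.withDensity fun x => ENNReal.ofReal (konnoDensity x),
    ⟨by rw [withDensity_apply _ MeasurableSet.univ, Measure.restrict_univ,
          lintegral_konnoDensity]⟩⟩

/-- The law of the sum of two independent random variables with laws `μ` and `ν`. -/
def indepSum (μ ν : ProbabilityMeasure ℝ) : ProbabilityMeasure ℝ :=
  ⟨((μ : Measure ℝ).prod (ν : Measure ℝ)).map (fun p : ℝ × ℝ => p.1 + p.2),
    Measure.isProbabilityMeasure_map (by fun_prop)⟩

/-- The law of the product of two independent random variables with laws `μ` and `ν`. -/
def indepMul (μ ν : ProbabilityMeasure ℝ) : ProbabilityMeasure ℝ :=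
  ⟨((μ : Measure ℝ).prod (ν : Measure ℝ)).map (fun p : ℝ × ℝ => p.1 * p.2),
    Measure.isProbabilityMeasure_map (by fun_prop)⟩

end ManyCoins

end

/-! At a fixed momentum `k`, a step acts on one tensor factor only: the coin flip mixes the two
components of one coin, and the shift becomes a phase read off from that same coin. A product
initial state therefore stays a product (`fourierState_evolve`), and Parseval with the momentum
displaced by `u` writes the characteristic function at `u` as the mean over `k` of a product of
single-coin overlaps (`latticeCharFun_positionLaw`). Independent random coins only replace each
overlap by its average (`latticeCharFun_uniform_bind`).

It remains to understand one coin. Started from `φ₀`, it contributes `cos u` after one visit and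
`cos² u - i sin u sin(2k+u)` after two; a random basis coin visited twice contributes `cos² u`.
Powers of `cos u` produce the Gaussian factor at scale `√t`. The `m` twice-visited `φ₀` coins
produce the phase `exp(-i m u sin 2k)` at scale `m`, whose mean over `k` is an arcsine
characteristic function. The two scales meet at `β = 1/2`.

A random coin visited `n` times contributes `cos(n(ω(k+u) - ω(k)))` up to an error `O(u²)` uniform
in `n`, where `ω` is `quasiEnergy` (`meanOverlap_eq`). With `M` coins visited `d` or `d+1` times,
the product tends to `exp(-(L v(k))²/2)`, where `v = -ω'` is `groupVelocity` and `L²` is the limit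
of `M d² u²`. For uniform `k` the speed `v(k)` has density `ρ`, hence the law of a product. For `β =
1` a single coin is left and the limit integrand is `cos(L v(k))`; for `β = 0`, `θ = 1/2` eventually
`d = 1` and the characteristic function is exactly a power of the cosine.

Convergence is pointwise in `k` with integrands bounded by `1`, so dominated convergence
(`tendsto_mean`) and Lévy's continuity theorem (`tendsto_rescaled`) conclude. -/

noncomputable section

namespace ManyCoins

/-! ### Fourier analysis of the walk -/

/-- One step of a single coin at momentum `k`. -/
def momentumStep (k : ℝ) (v : Fin 2 → ℂ) : Fin 2 → ℂ :=
  fun ε => Complex.exp (k * chirality ε * Complex.I) * ∑ η, hadamard ε η * v η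

/-- The number of times at which the coin `j` has been used before time `t`. -/
def visits (M t j : ℕ) : ℕ := Nat.count (fun s => s % M = j) t

/-- The Fourier transform of a state in the position variable. -/
def fourierState {M : ℕ} (Ψ : State M) (k : ℝ) (ξ : Fin M → Fin 2) : ℂ :=
  ∑' x : ℤ, Complex.exp (k * x * Complex.I) * Ψ x ξ

theorem initState_eq_zero {M : ℕ} (φ : Fin M → Qubit) {x : ℤ} (hx : x ≠ 0) (ξ : Fin M → Fin 2) :
    initState φ x ξ = 0 := by simp [initState, hx]

theorem abs_chirality (b : Fin 2) : |chirality b| = 1 := by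
  fin_cases b <;> simp [chirality]

/-- The walk moves one site per step. This finite speed turns every sum over positions into a finite
one, so no summability question arises in the Fourier transform. -/
theorem evolve_eq_zero {M : ℕ} [NeZero M] (φ : Fin M → Qubit) (t : ℕ) {x : ℤ} (hx : t < |x|)
    (ξ : Fin M → Fin 2) : evolve (initState φ) t x ξ = 0 := by
  induction t generalizing x ξ with
  | zero => exact initState_eq_zero φ (by simpa using hx) ξ
  | succ t ih =>
    have h : ∀ b : Fin 2, (t : ℤ) < |x - chirality b| := by
      intro b
      have h1 := abs_sub_abs_le_abs_sub x (chirality b)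
      rw [abs_chirality] at h1
      push_cast at hx
      linarith
    simp only [evolve, shift, coinFlip]
    exact Finset.sum_eq_zero fun η _ => by rw [ih (h _), mul_zero]

theorem finite_support_evolve {M : ℕ} [NeZero M] (φ : Fin M → Qubit) (t : ℕ)
    (ξ : Fin M → Fin 2) : (Function.support fun x => evolve (initState φ) t x ξ).Finite := by
  refine (Set.finite_Icc (-(t : ℤ)) t).subset fun x hx => ?_
  by_contra h
  refine hx (evolve_eq_zero φ t ?_ ξ)
  by_contra h2
  exact h (abs_le.1 (not_lt.1 h2))

theorem fourierState_shift {M : ℕ} (j : Fin M) (Ψ : State M) (k : ℝ) (ξ : Fin M → Fin 2) :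
    fourierState (shift j Ψ) k ξ
      = Complex.exp (k * chirality (ξ j) * Complex.I) * fourierState Ψ k ξ := by
  unfold fourierState shift
  rw [← (Equiv.addRight (chirality (ξ j))).tsum_eq, ← tsum_mul_left]
  refine tsum_congr fun x => ?_
  simp only [Equiv.coe_addRight, add_sub_cancel_right]
  rw [← mul_assoc, ← Complex.exp_add]
  push_cast
  ring_nf

theorem fourierState_coinFlip {M : ℕ} (j : Fin M) (Ψ : State M)
    (hΨ : ∀ ξ, (Function.support fun x => Ψ x ξ).Finite) (k : ℝ) (ξ : Fin M → Fin 2) :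
    fourierState (coinFlip j Ψ) k ξ
      = ∑ η, hadamard (ξ j) η * fourierState Ψ k (Function.update ξ j η) := by
  unfold fourierState coinFlip
  simp only [← tsum_mul_left]
  rw [← Summable.tsum_finsetSum]
  · refine tsum_congr fun x => ?_
    rw [Finset.mul_sum]
    exact Finset.sum_congr rfl fun η _ => by ring
  · intro η _
    refine summable_of_hasFiniteSupport ((hΨ (Function.update ξ j η)).subset fun x hx => ?_)
    intro h
    exact hx (by simp only at h; simp [h])

theorem visits_zero (M j : ℕ) : visits M 0 j = 0 := by simp [visits]

theorem visits_succ (M t j : ℕ) :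
    visits M (t + 1) j = visits M t j + if t % M = j then 1 else 0 := by
  simp [visits, Nat.count_succ]

theorem visits_eq {M : ℕ} (hM : 0 < M) (t : ℕ) {j : ℕ} (hj : j < M) :
    visits M t j = t / M + if j < t % M then 1 else 0 := by
  have h := Nat.count_modEq_card t hM j
  rw [Nat.mod_eq_of_lt hj] at h
  rw [← h]
  unfold visits
  congr 1
  funext s
  simp [Nat.ModEq, Nat.mod_eq_of_lt hj]

/-- Both the coin flip and the Fourier-transformed shift involve coin `t mod M` alone, so the other
factors come out of the sum over `η` and only the active factor gains one iterate. -/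
theorem fourierState_evolve {M : ℕ} [NeZero M] (φ : Fin M → Qubit) (t : ℕ) (k : ℝ)
    (ξ : Fin M → Fin 2) :
    fourierState (evolve (initState φ) t) k ξ
      = ∏ j : Fin M, (momentumStep k)^[visits M t j] (φ j).1.ofLp (ξ j) := by
  induction t generalizing ξ with
  | zero =>
    simp only [visits_zero, Function.iterate_zero, id]
    unfold fourierState evolve
    rw [tsum_eq_single 0 fun x hx => by rw [initState_eq_zero φ hx, mul_zero]]
    simp [initState]
  | succ t ih =>
    set j₀ : Fin M := Fin.ofNat M t with hj₀
    have hv : ∀ j : Fin M, visits M (t + 1) j = visits M t j + if j = j₀ then 1 else 0 := by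
      intro j
      rw [visits_succ]
      congr 1
      refine if_congr ?_ rfl rfl
      rw [hj₀, Fin.ext_iff, Fin.val_ofNat]
      exact eq_comm
    rw [evolve, fourierState_shift, fourierState_coinFlip _ _ (finite_support_evolve φ t)]
    simp only [ih, ← hj₀]
    rw [← Finset.mul_prod_erase Finset.univ _ (Finset.mem_univ j₀), hv, if_pos rfl,
      Function.iterate_succ_apply', momentumStep,
      mul_assoc (Complex.exp (k * chirality (ξ j₀) * Complex.I))]
    congr 1
    rw [Finset.sum_mul]
    refine Finset.sum_congr rfl fun η _ => ?_
    rw [← Finset.mul_prod_erase Finset.univ _ (Finset.mem_univ j₀), Function.update_self,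
      mul_assoc]
    congr 2
    refine Finset.prod_congr rfl fun j hj => ?_
    have hne := Finset.ne_of_mem_erase hj
    rw [Function.update_of_ne hne, hv, if_neg hne, add_zero]

theorem integral_exp_int_mul (n : ℤ) :
    ∫ k in (-Real.pi)..Real.pi, Complex.exp (k * n * Complex.I)
      = (if n = 0 then 2 * Real.pi else 0 : ℂ) := by
  split_ifs with h
  · subst h
    simp
    ring
  · have hc : (n : ℂ) * Complex.I ≠ 0 := by simp [h]
    have e : ∀ k : ℝ, Complex.exp (k * n * Complex.I) = Complex.exp (n * Complex.I * k) := by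
      intro k; ring_nf
    simp only [e]
    rw [integral_exp_mul_complex hc, div_eq_zero_iff]
    left
    rw [sub_eq_zero, Complex.exp_eq_exp_iff_exists_int]
    exact ⟨n, by push_cast; ring⟩

/-- Displacing the momentum by `u` in one factor multiplies `f x` by `exp(iux)`; orthogonality of
the exponentials then leaves only the diagonal. -/
theorem parseval_shift (S : Finset ℤ) (f : ℤ → ℂ) (u : ℝ) :
    ∫ k in (-Real.pi)..Real.pi,
      (starRingEnd ℂ) (∑ x ∈ S, Complex.exp (k * x * Complex.I) * f x)
        * ∑ x ∈ S, Complex.exp ((k + u : ℝ) * x * Complex.I) * f x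
      = 2 * Real.pi * ∑ x ∈ S, (‖f x‖ ^ 2 : ℝ) * Complex.exp (u * x * Complex.I) := by
  have e : ∀ k : ℝ, (starRingEnd ℂ) (∑ x ∈ S, Complex.exp (k * x * Complex.I) * f x)
        * ∑ x ∈ S, Complex.exp ((k + u : ℝ) * x * Complex.I) * f x
      = ∑ x ∈ S, ∑ y ∈ S, Complex.exp (k * (y - x : ℤ) * Complex.I)
          * ((starRingEnd ℂ) (f x) * f y * Complex.exp (u * y * Complex.I)) := by
    intro k
    rw [map_sum, Finset.sum_mul_sum]
    refine Finset.sum_congr rfl fun x _ => Finset.sum_congr rfl fun y _ => ?_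
    rw [map_mul, ← Complex.exp_conj]
    have h : Complex.exp ((k + u : ℝ) * y * Complex.I)
        = Complex.exp (k * (y - x : ℤ) * Complex.I) * Complex.exp (k * x * Complex.I)
          * Complex.exp (u * y * Complex.I) := by
      rw [← Complex.exp_add, ← Complex.exp_add]
      push_cast
      ring_nf
    have h2 : Complex.exp ((starRingEnd ℂ) (k * x * Complex.I))
        * Complex.exp (k * x * Complex.I) = 1 := by
      rw [← Complex.exp_add]
      simp
    rw [h]
    linear_combination (Complex.exp (k * (y - x : ℤ) * Complex.I) * (starRingEnd ℂ) (f x) * f y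
      * Complex.exp (u * y * Complex.I)) * h2
  simp only [e]
  rw [intervalIntegral.integral_finsetSum fun x _ => by
    refine Continuous.intervalIntegrable ?_ _ _
    fun_prop]
  rw [Finset.mul_sum]
  refine Finset.sum_congr rfl fun x hx => ?_
  rw [intervalIntegral.integral_finsetSum fun y _ => by
    refine Continuous.intervalIntegrable ?_ _ _
    fun_prop]
  simp only [intervalIntegral.integral_mul_const, integral_exp_int_mul]
  rw [Finset.sum_eq_single x]
  · simp [← Complex.normSq_eq_conj_mul_self, Complex.normSq_eq_norm_sq]
  · intro y _ hy
    rw [if_neg (sub_ne_zero.2 hy), zero_mul]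
  · exact fun h => absurd hx h

/-! ### Characteristic functions as momentum averages of products of overlaps -/

/-- The overlap of the single-coin evolutions at the momenta `k` and `k + u`. -/
def overlap (n : ℕ) (k u : ℝ) (v : Fin 2 → ℂ) : ℂ :=
  ∑ ε, (starRingEnd ℂ) ((momentumStep k)^[n] v ε) * (momentumStep (k + u))^[n] v ε

theorem continuous_momentumStep_iterate (n : ℕ) (v : Fin 2 → ℂ) :
    Continuous fun k => (momentumStep k)^[n] v := by
  induction n with
  | zero => simpa using continuous_const
  | succ n ih =>
    simp only [Function.iterate_succ_apply']
    refine continuous_pi fun ε => ?_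
    unfold momentumStep
    have : ∀ η, Continuous fun k => (momentumStep k)^[n] v η := fun η =>
      (continuous_apply η).comp ih
    fun_prop

theorem continuous_overlap (n : ℕ) (u : ℝ) (v : Fin 2 → ℂ) :
    Continuous fun k => overlap n k u v := by
  unfold overlap
  refine continuous_finsetSum _ fun ε _ => ?_
  have h := continuous_momentumStep_iterate n v
  have h1 : Continuous fun k => (momentumStep k)^[n] v ε := (continuous_apply ε).comp h
  have h2 : Continuous fun k => (momentumStep (k + u))^[n] v ε :=
    h1.comp (continuous_id.add continuous_const)
  exact (Complex.continuous_conj.comp h1).mul h2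

theorem sum_norm_sq_momentumStep (k : ℝ) (v : Fin 2 → ℂ) :
    ∑ ε, ‖momentumStep k v ε‖ ^ 2 = ∑ ε, ‖v ε‖ ^ 2 := by
  have h : ∀ ε, ‖Complex.exp (k * chirality ε * Complex.I)‖ = 1 := by
    intro ε
    rw [show (k : ℂ) * chirality ε * Complex.I = ((k * chirality ε : ℝ) : ℂ) * Complex.I by
      push_cast; ring, Complex.norm_exp_ofReal_mul_I]
  simp only [momentumStep, norm_mul, h, one_mul, Fin.sum_univ_two]
  exact hadamard_norm _ _

theorem sum_norm_sq_momentumStep_iterate (n : ℕ) (k : ℝ) (v : Fin 2 → ℂ) :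
    ∑ ε, ‖(momentumStep k)^[n] v ε‖ ^ 2 = ∑ ε, ‖v ε‖ ^ 2 := by
  induction n with
  | zero => rfl
  | succ n ih => rw [Function.iterate_succ_apply', sum_norm_sq_momentumStep, ih]

theorem sum_norm_sq_qubit (φ : Qubit) : ∑ ε, ‖φ.1.ofLp ε‖ ^ 2 = 1 := by
  rw [← EuclideanSpace.norm_sq_eq, φ.2, one_pow]

/-- Cauchy–Schwarz for two unit vectors, since each single-coin step is unitary. This supplies the
dominating constant for the integrals over `k`. -/
theorem norm_overlap_le (n : ℕ) (k u : ℝ) (φ : Qubit) : ‖overlap n k u φ.1.ofLp‖ ≤ 1 := by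
  have h1 := sum_norm_sq_momentumStep_iterate n k φ.1.ofLp
  have h2 := sum_norm_sq_momentumStep_iterate n (k + u) φ.1.ofLp
  rw [sum_norm_sq_qubit] at h1 h2
  unfold overlap
  rw [Fin.sum_univ_two] at *
  refine (norm_add_le _ _).trans ?_
  simp only [norm_mul, RCLike.norm_conj]
  nlinarith [sq_nonneg (‖(momentumStep k)^[n] φ.1.ofLp 0‖
      - ‖(momentumStep (k + u))^[n] φ.1.ofLp 0‖),
    sq_nonneg (‖(momentumStep k)^[n] φ.1.ofLp 1‖ - ‖(momentumStep (k + u))^[n] φ.1.ofLp 1‖)]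

/-- The characteristic function of a law on the integers. -/
def latticeCharFun (p : PMF ℤ) (u : ℝ) : ℂ :=
  ∑' x : ℤ, ((p x).toReal : ℂ) * Complex.exp (u * x * Complex.I)

theorem charFun_rescaled (p : PMF ℤ) (t : ℕ) (θ u : ℝ) :
    charFun (rescaled p t θ : Measure ℝ) u = latticeCharFun p (u / (t : ℝ) ^ θ) := by
  rw [charFun_apply_real]
  unfold rescaled latticeCharFun
  rw [ProbabilityMeasure.coe_mk, integral_map (measurable_of_countable _).aemeasurable
    (by fun_prop), PMF.integral_eq_tsum]
  · refine tsum_congr fun x => ?_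
    rw [Complex.real_smul]
    push_cast
    ring_nf
  · refine Integrable.of_bound (C := 1) (measurable_of_countable _).aestronglyMeasurable
      (ae_of_all _ fun x => ?_)
    rw [← Complex.ofReal_mul, Complex.norm_exp_ofReal_mul_I]

/-- Expanding the product of overlaps gives a sum over all coin configurations `ξ`, and Parseval
applies to each `ξ` separately. -/
theorem latticeCharFun_positionLaw {M : ℕ} [NeZero M] (φ : Fin M → Qubit) (t : ℕ) (u : ℝ) :
    latticeCharFun (positionLaw φ t) u = (2 * Real.pi)⁻¹ *
      ∫ k in (-Real.pi)..Real.pi, ∏ j : Fin M, overlap (visits M t j) k u (φ j).1.ofLp := by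
  set S : Finset ℤ := Finset.Icc (-(t : ℤ)) t with hS
  have hout : ∀ x ∉ S, ∀ ξ, evolve (initState φ) t x ξ = 0 := by
    intro x hx ξ
    refine evolve_eq_zero φ t ?_ ξ
    by_contra h2
    exact hx (Finset.mem_Icc.2 (abs_le.1 (not_lt.1 h2)))
  have hf : ∀ k ξ, ∏ j : Fin M, (momentumStep k)^[visits M t j] (φ j).1.ofLp (ξ j)
      = ∑ x ∈ S, Complex.exp (k * x * Complex.I) * evolve (initState φ) t x ξ := by
    intro k ξ
    rw [← fourierState_evolve, fourierState, tsum_eq_sum fun x hx => by rw [hout x hx, mul_zero]]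
  have hprod : ∀ k, ∏ j : Fin M, overlap (visits M t j) k u (φ j).1.ofLp
      = ∑ ξ : Fin M → Fin 2,
        (starRingEnd ℂ) (∑ x ∈ S, Complex.exp (k * x * Complex.I) * evolve (initState φ) t x ξ)
          * ∑ x ∈ S, Complex.exp ((k + u : ℝ) * x * Complex.I) * evolve (initState φ) t x ξ := by
    intro k
    unfold overlap
    rw [Finset.prod_univ_sum, Fintype.piFinset_univ]
    refine Finset.sum_congr rfl fun ξ _ => ?_
    rw [Finset.prod_mul_distrib, ← hf, ← hf, map_prod]
  simp only [hprod]
  rw [intervalIntegral.integral_finsetSum fun ξ _ => by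
    refine Continuous.intervalIntegrable ?_ _ _
    fun_prop]
  simp only [parseval_shift]
  rw [← Finset.mul_sum, ← mul_assoc, Finset.sum_comm]
  have hpi : (((2 * Real.pi)⁻¹ : ℝ) : ℂ) * (2 * Real.pi) = 1 := by
    push_cast
    exact inv_mul_cancel₀ (by simp [Real.pi_ne_zero])
  rw [hpi, one_mul]
  unfold latticeCharFun
  have hp : ∀ x, ((positionLaw φ t) x).toReal = posWeight (evolve (initState φ) t) x := fun x =>
    ENNReal.toReal_ofReal (posWeight_nonneg _ _)
  simp only [hp]
  rw [tsum_eq_sum (s := S)]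
  · refine Finset.sum_congr rfl fun x _ => ?_
    unfold posWeight
    rw [Complex.ofReal_sum, Finset.sum_mul]
  · intro x hx
    simp [posWeight, hout x hx]

theorem latticeCharFun_bind {ι : Type*} [Fintype ι] (p : PMF ι) (q : ι → PMF ℤ) (u : ℝ) :
    latticeCharFun (p.bind q) u = ∑ b, ((p b).toReal : ℂ) * latticeCharFun (q b) u := by
  unfold latticeCharFun
  simp only [← tsum_mul_left]
  rw [← Summable.tsum_finsetSum]
  · refine tsum_congr fun x => ?_
    rw [PMF.bind_apply, tsum_fintype, ENNReal.toReal_sum fun b _ =>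
      ENNReal.mul_ne_top (p.apply_ne_top b) ((q b).apply_ne_top x)]
    simp only [ENNReal.toReal_mul]
    push_cast
    rw [Finset.sum_mul]
    exact Finset.sum_congr rfl fun b _ => by ring
  · intro b _
    refine Summable.mul_left _ (Summable.of_norm ?_)
    have h : ∀ x : ℤ, ‖(((q b) x).toReal : ℂ) * Complex.exp (u * x * Complex.I)‖
        = ((q b) x).toReal := by
      intro x
      rw [norm_mul, show (u : ℂ) * x * Complex.I = ((u * x : ℝ) : ℂ) * Complex.I by push_cast; ring,
        Complex.norm_exp_ofReal_mul_I, mul_one, Complex.norm_real,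
        Real.norm_of_nonneg ENNReal.toReal_nonneg]
    simp only [h]
    exact ENNReal.summable_toReal (by rw [(q b).tsum_coe]; exact ENNReal.one_ne_top)

/-- At fixed momentum the integrand is a product over coins, so by independence the average over the
bits can be taken factor by factor. A coin whose qubit ignores its bit is allowed. -/
theorem latticeCharFun_uniform_bind {M : ℕ} [NeZero M] (φ : Fin M → Fin 2 → Qubit) (t : ℕ)
    (u : ℝ) :
    latticeCharFun ((PMF.uniformOfFintype (Fin M → Fin 2)).bind
        fun b => positionLaw (fun j => φ j (b j)) t) u = (2 * Real.pi)⁻¹ *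
      ∫ k in (-Real.pi)..Real.pi, ∏ j : Fin M,
        (1 / 2 * ∑ b, overlap (visits M t j) k u (φ j b).1.ofLp) := by
  rw [latticeCharFun_bind]
  simp only [latticeCharFun_positionLaw, PMF.uniformOfFintype_apply]
  rw [← Finset.mul_sum, ← Finset.mul_sum, mul_left_comm]
  congr 1
  rw [← intervalIntegral.integral_finsetSum fun b _ =>
    (continuous_finsetProd _ fun j _ => continuous_overlap _ _ _).intervalIntegrable _ _,
    ← intervalIntegral.integral_const_mul]
  refine intervalIntegral.integral_congr fun k _ => ?_
  rw [Finset.prod_mul_distrib, Finset.prod_univ_sum, Fintype.piFinset_univ]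
  congr 1
  simp

/-! ### Overlaps of a single coin -/

theorem chirality_zero : chirality 0 = 1 := rfl

theorem chirality_one : chirality 1 = -1 := rfl

theorem inv_sqrt_two_sq : (((Real.sqrt 2 : ℝ) : ℂ)⁻¹) ^ 2 = 1 / 2 := by
  rw [inv_pow, ← Complex.ofReal_pow, Real.sq_sqrt (by norm_num)]
  norm_num

theorem momentumStep_zero (k : ℝ) (v : Fin 2 → ℂ) : momentumStep k v 0
    = Complex.exp (k * Complex.I) * (((Real.sqrt 2 : ℝ) : ℂ)⁻¹ * (v 0 + v 1)) := by
  simp [momentumStep, hadamard, chirality_zero, Fin.sum_univ_two]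
  ring

theorem momentumStep_one (k : ℝ) (v : Fin 2 → ℂ) : momentumStep k v 1
    = Complex.exp (-(k * Complex.I)) * (((Real.sqrt 2 : ℝ) : ℂ)⁻¹ * (v 0 - v 1)) := by
  simp [momentumStep, hadamard, chirality_one, Fin.sum_univ_two]
  ring

theorem symQubit_zero : symQubit.1.ofLp 0 = ((Real.sqrt 2 : ℝ) : ℂ)⁻¹ := by
  simp [symQubit]

theorem symQubit_one : symQubit.1.ofLp 1 = Complex.I * ((Real.sqrt 2 : ℝ) : ℂ)⁻¹ := by
  simp [symQubit, div_eq_mul_inv]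

theorem conj_inv_sqrt_two :
    (starRingEnd ℂ) (((Real.sqrt 2 : ℝ) : ℂ)⁻¹) = ((Real.sqrt 2 : ℝ) : ℂ)⁻¹ := by
  rw [map_inv₀, Complex.conj_ofReal]

theorem conj_exp_mul_I (k : ℝ) :
    (starRingEnd ℂ) (Complex.exp (k * Complex.I)) = Complex.exp (-(k * Complex.I)) := by
  rw [← Complex.exp_conj]; simp

theorem conj_exp_neg_mul_I (k : ℝ) :
    (starRingEnd ℂ) (Complex.exp (-(k * Complex.I))) = Complex.exp (k * Complex.I) := by
  rw [← Complex.exp_conj]; simp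

theorem exp_mul_exp_neg (z : ℂ) : Complex.exp z * Complex.exp (-z) = 1 := by
  rw [← Complex.exp_add, add_neg_cancel, Complex.exp_zero]

theorem overlap_symQubit_one (k u : ℝ) :
    overlap 1 k u symQubit.1.ofLp = Complex.cos u := by
  simp only [overlap, Function.iterate_one, Fin.sum_univ_two, momentumStep_zero, momentumStep_one,
    symQubit_zero, symQubit_one, map_mul, map_add, map_sub, conj_inv_sqrt_two, conj_exp_mul_I,
    conj_exp_neg_mul_I, Complex.conj_I, Complex.ofReal_add, add_mul (k : ℂ), neg_add,
    Complex.exp_add, Complex.cos, neg_mul]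
  have h1 := exp_mul_exp_neg (k * Complex.I)
  have h2 := exp_mul_exp_neg (u * Complex.I)
  have h3 := inv_sqrt_two_sq
  have h4 := Complex.I_sq
  generalize Complex.exp (k * Complex.I) = a at *
  generalize Complex.exp (-(k * Complex.I)) = a' at *
  generalize Complex.exp (u * Complex.I) = b at *
  generalize Complex.exp (-(u * Complex.I)) = b' at *
  generalize ((Real.sqrt 2 : ℝ) : ℂ)⁻¹ = s at *
  generalize Complex.I = i at *
  grind

/-- A second visit to a `φ₀` coin creates a term of first order in `u` that depends on `k`. It is
the source of the arcsine law; after one visit there is no such term. -/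
theorem overlap_symQubit_two (k u : ℝ) :
    overlap 2 k u symQubit.1.ofLp
      = Complex.cos u ^ 2 - Complex.I * Complex.sin u * Complex.sin (2 * k + u) := by
  simp only [overlap, Function.iterate_succ, Function.iterate_zero, Function.comp_apply, id,
    Fin.sum_univ_two, momentumStep_zero, momentumStep_one,
    symQubit_zero, symQubit_one, map_mul, map_add, map_sub, conj_inv_sqrt_two, conj_exp_mul_I,
    conj_exp_neg_mul_I, Complex.conj_I, Complex.ofReal_add, two_mul, add_mul, neg_add,
    Complex.exp_add, Complex.cos, Complex.sin, neg_mul]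
  have h1 := exp_mul_exp_neg (k * Complex.I)
  have h2 := exp_mul_exp_neg (u * Complex.I)
  have h3 := inv_sqrt_two_sq
  have h4 := Complex.I_sq
  generalize Complex.exp (k * Complex.I) = a at *
  generalize Complex.exp (-(k * Complex.I)) = a' at *
  generalize Complex.exp (u * Complex.I) = b at *
  generalize Complex.exp (-(u * Complex.I)) = b' at *
  generalize ((Real.sqrt 2 : ℝ) : ℂ)⁻¹ = s at *
  generalize Complex.I = i at *
  grind

/-- The overlap averaged over the two basis qubits. -/
def meanOverlap (n : ℕ) (k u : ℝ) : ℂ := 1 / 2 * ∑ b, overlap n k u (ket b).1.ofLp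

theorem continuous_meanOverlap (n : ℕ) (u : ℝ) : Continuous fun k => meanOverlap n k u := by
  unfold meanOverlap
  have := fun b => continuous_overlap n u (ket b).1.ofLp
  fun_prop

theorem norm_meanOverlap_le (n : ℕ) (k u : ℝ) : ‖meanOverlap n k u‖ ≤ 1 := by
  unfold meanOverlap
  rw [Fin.sum_univ_two, norm_mul]
  have h := norm_add_le (overlap n k u (ket 0).1.ofLp) (overlap n k u (ket 1).1.ofLp)
  have h0 := norm_overlap_le n k u (ket 0)
  have h1 := norm_overlap_le n k u (ket 1)
  norm_num
  linarith

theorem ket_apply (b ε : Fin 2) : (ket b).1.ofLp ε = if ε = b then 1 else 0 := by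
  simp [ket]

/-! ### Spectral formula for the averaged overlap after `n` visits -/

/-- The angle of the eigenvalues of the one-step evolution at momentum `k`. -/
def quasiEnergy (k : ℝ) : ℝ := Real.arccos (Real.sin k / Real.sqrt 2)

theorem sin_div_sqrt_two_sq (k : ℝ) : (Real.sin k / Real.sqrt 2) ^ 2 = Real.sin k ^ 2 / 2 := by
  rw [div_pow, Real.sq_sqrt (by norm_num)]

theorem abs_sin_div_sqrt_two_lt (k : ℝ) : |Real.sin k / Real.sqrt 2| < 1 := by
  rw [← sq_lt_one_iff_abs_lt_one, sin_div_sqrt_two_sq]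
  linarith [Real.sin_sq_le_one k]

theorem cos_quasiEnergy (k : ℝ) : Real.cos (quasiEnergy k) = Real.sin k / Real.sqrt 2 :=
  have h := abs_lt.1 (abs_sin_div_sqrt_two_lt k)
  Real.cos_arccos h.1.le h.2.le

theorem sin_quasiEnergy_sq (k : ℝ) : Real.sin (quasiEnergy k) ^ 2 = 1 - Real.sin k ^ 2 / 2 := by
  rw [Real.sin_sq, cos_quasiEnergy, sin_div_sqrt_two_sq]

theorem sin_quasiEnergy_pos (k : ℝ) : 0 < Real.sin (quasiEnergy k) := by
  have h := abs_lt.1 (abs_sin_div_sqrt_two_lt k)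
  rw [quasiEnergy, Real.sin_arccos, sin_div_sqrt_two_sq]
  exact Real.sqrt_pos.2 (by linarith [Real.sin_sq_le_one k])

/-- The two eigenvalues stay uniformly apart, because `sin² ω = 1 - sin² k / 2 ≥ 1/2`. This keeps
the denominators of `meanOverlap_eq` away from zero. -/
theorem half_le_sin_mul_sin_quasiEnergy (k l : ℝ) :
    1 / 2 ≤ Real.sin (quasiEnergy k) * Real.sin (quasiEnergy l) := by
  have h : ∀ k, Real.sqrt (1 / 2) ≤ Real.sin (quasiEnergy k) := by
    intro k
    refine Real.sqrt_le_iff.2 ⟨(sin_quasiEnergy_pos k).le, ?_⟩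
    rw [sin_quasiEnergy_sq]
    linarith [Real.sin_sq_le_one k]
  have h2 := mul_le_mul (h k) (h l) (Real.sqrt_nonneg _) (sin_quasiEnergy_pos k).le
  rwa [Real.mul_self_sqrt (by norm_num)] at h2

/-- The speed of a walker of momentum `k`, up to sign. -/
def groupVelocity (k : ℝ) : ℝ := Real.cos k / Real.sqrt (1 + Real.cos k ^ 2)

theorem hasDerivAt_quasiEnergy (k : ℝ) : HasDerivAt quasiEnergy (-groupVelocity k) k := by
  have h := abs_lt.1 (abs_sin_div_sqrt_two_lt k)
  have hd := (Real.hasDerivAt_arccos h.1.ne' h.2.ne).comp k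
    ((Real.hasDerivAt_sin k).div_const (Real.sqrt 2))
  refine hd.congr_deriv ?_
  have h2 : 1 + Real.cos k ^ 2 = 2 * (1 - (Real.sin k / Real.sqrt 2) ^ 2) := by
    rw [sin_div_sqrt_two_sq, Real.cos_sq']
    ring
  rw [groupVelocity, h2, Real.sqrt_mul (by norm_num)]
  have h3 : 0 < Real.sqrt (1 - (Real.sin k / Real.sqrt 2) ^ 2) := by
    refine Real.sqrt_pos.2 ?_
    rw [sin_div_sqrt_two_sq]
    linarith [Real.sin_sq_le_one k]
  field_simp

/-- The characteristic roots are `i exp(±iγ)`. Separating the factor `i ^ n` leaves the recurrence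
of `cos (nγ)` and `sin (nγ)`. -/
theorem linear_recurrence_eq {a : ℕ → ℂ} {γ : ℝ} (hγ : Real.sin γ ≠ 0)
    (ha : ∀ n, a (n + 2) = 2 * Complex.I * Real.cos γ * a (n + 1) + a n) (n : ℕ) :
    a n = Complex.I ^ n * (Real.cos (n * γ) * a 0
      + (Real.sin (n * γ) / Real.sin γ : ℝ) * (-Complex.I * a 1 - Real.cos γ * a 0)) := by
  induction n using Nat.twoStepInduction with
  | zero => simp
  | one =>
    simp only [Nat.cast_one, one_mul, div_self hγ]
    push_cast
    linear_combination (a 1) * Complex.I_sq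
  | more n h1 h2 =>
    have ec : Real.cos ((n + 2 : ℕ) * γ)
        = 2 * Real.cos γ * Real.cos ((n + 1 : ℕ) * γ) - Real.cos (n * γ) := by
      have e1 : ((n + 2 : ℕ) : ℝ) * γ = (n + 1 : ℕ) * γ + γ := by push_cast; ring
      have e2 : (n : ℝ) * γ = (n + 1 : ℕ) * γ - γ := by push_cast; ring
      rw [e1, e2, Real.cos_add, Real.cos_sub]
      ring
    have es : Real.sin ((n + 2 : ℕ) * γ)
        = 2 * Real.cos γ * Real.sin ((n + 1 : ℕ) * γ) - Real.sin (n * γ) := by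
      have e1 : ((n + 2 : ℕ) : ℝ) * γ = (n + 1 : ℕ) * γ + γ := by push_cast; ring
      have e2 : (n : ℝ) * γ = (n + 1 : ℕ) * γ - γ := by push_cast; ring
      rw [e1, e2, Real.sin_add, Real.sin_sub]
      ring
    rw [ha, h1, h2, ec, es, pow_succ, pow_succ]
    push_cast
    have h4 := Complex.I_sq
    linear_combination (Complex.I ^ n * (Complex.cos (n * γ) * a 0
      + Complex.sin (n * γ) / Complex.sin γ * (-Complex.I * a 1 - Complex.cos γ * a 0))) * h4

/-- Cayley–Hamilton: the one-step matrix has determinant `-1` and trace `i √2 sin k = 2 i cos ω(k)`.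
-/
theorem momentumStep_momentumStep (k : ℝ) (v : Fin 2 → ℂ) (ε : Fin 2) :
    momentumStep k (momentumStep k v) ε
      = 2 * Complex.I * Real.cos (quasiEnergy k) * momentumStep k v ε + v ε := by
  have h1 := exp_mul_exp_neg (k * Complex.I)
  have h3 := inv_sqrt_two_sq
  have h4 := Complex.I_sq
  have hε : ε = 0 ∨ ε = 1 := by omega
  rw [cos_quasiEnergy]
  push_cast
  rw [div_eq_mul_inv]
  rcases hε with rfl | rfl <;>
  · simp only [momentumStep_zero, momentumStep_one, Complex.sin, neg_mul]
    generalize Complex.exp (k * Complex.I) = a at *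
    generalize Complex.exp (-(k * Complex.I)) = a' at *
    generalize ((Real.sqrt 2 : ℝ) : ℂ)⁻¹ = s at *
    generalize Complex.I = i at *
    grind

theorem momentumStep_iterate (n : ℕ) (k : ℝ) (v : Fin 2 → ℂ) (ε : Fin 2) :
    (momentumStep k)^[n] v ε = Complex.I ^ n * (Real.cos (n * quasiEnergy k) * v ε
      + (Real.sin (n * quasiEnergy k) / Real.sin (quasiEnergy k) : ℝ)
        * (-Complex.I * momentumStep k v ε - Real.cos (quasiEnergy k) * v ε)) := by
  refine linear_recurrence_eq (a := fun n => (momentumStep k)^[n] v ε)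
    (sin_quasiEnergy_pos k).ne' (fun n => ?_) n
  simp only [Function.iterate_succ_apply']
  exact momentumStep_momentumStep _ _ _

/-- The left side is a normalised trace. With `U` the one-step matrix, `-iU - cos ω` is traceless,
so the cross terms vanish, and half the trace of `U(k)* U(k+u)` is `cos u`. -/
theorem mean_inner_of_linear (k u p q p' q' : ℝ) :
    1 / 2 * ∑ b : Fin 2, ∑ ε : Fin 2,
      (starRingEnd ℂ) (p * (ket b).1.ofLp ε + q * (-Complex.I * momentumStep k (ket b).1.ofLp ε
        - Real.cos (quasiEnergy k) * (ket b).1.ofLp ε))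
      * (p' * (ket b).1.ofLp ε + q' * (-Complex.I * momentumStep (k + u) (ket b).1.ofLp ε
        - Real.cos (quasiEnergy (k + u)) * (ket b).1.ofLp ε))
      = p * p' + q * q' * (Real.cos u
          - Real.cos (quasiEnergy k) * Real.cos (quasiEnergy (k + u))) := by
  have h1 := exp_mul_exp_neg (k * Complex.I)
  have h2 := exp_mul_exp_neg (u * Complex.I)
  have h3 := inv_sqrt_two_sq
  have h4 := Complex.I_sq
  rw [cos_quasiEnergy, cos_quasiEnergy]
  simp only [Fin.sum_univ_two, ket_apply, momentumStep_zero, momentumStep_one, map_mul, map_add,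
    map_sub, map_neg, conj_inv_sqrt_two, conj_exp_mul_I, conj_exp_neg_mul_I, Complex.conj_I,
    Complex.conj_ofReal, if_true, zero_ne_one, one_ne_zero, if_false, map_one, map_zero]
  push_cast
  simp only [div_eq_mul_inv _ ((Real.sqrt 2 : ℝ) : ℂ), add_mul, neg_add, Complex.exp_add,
    Complex.cos, Complex.sin, neg_mul]
  generalize Complex.exp (k * Complex.I) = a at *
  generalize Complex.exp (-(k * Complex.I)) = a' at *
  generalize Complex.exp (u * Complex.I) = b at *
  generalize Complex.exp (-(u * Complex.I)) = b' at *
  generalize ((Real.sqrt 2 : ℝ) : ℂ)⁻¹ = s at *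
  generalize Complex.I = i at *
  grind

/-- Written so that the first term carries the growth in `n`, while in the second `n` occurs only
inside bounded sines and the remaining difference of cosines is of order `u²`. -/
theorem meanOverlap_eq (n : ℕ) (k u : ℝ) :
    meanOverlap n k u = (Real.cos (n * (quasiEnergy (k + u) - quasiEnergy k))
      + Real.sin (n * quasiEnergy k) * Real.sin (n * quasiEnergy (k + u))
        * (Real.cos u - Real.cos (quasiEnergy (k + u) - quasiEnergy k))
        / (Real.sin (quasiEnergy k) * Real.sin (quasiEnergy (k + u))) : ℝ) := by
  have hI : (starRingEnd ℂ) (Complex.I ^ n) * Complex.I ^ n = 1 := by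
    rw [← Complex.normSq_eq_conj_mul_self, Complex.normSq_eq_norm_sq]
    simp
  have h := mean_inner_of_linear k u (Real.cos (n * quasiEnergy k))
    (Real.sin (n * quasiEnergy k) / Real.sin (quasiEnergy k))
    (Real.cos (n * quasiEnergy (k + u)))
    (Real.sin (n * quasiEnergy (k + u)) / Real.sin (quasiEnergy (k + u)))
  refine (Eq.trans ?_ h).trans ?_
  · unfold meanOverlap overlap
    simp only [momentumStep_iterate n, map_mul (starRingEnd ℂ) (Complex.I ^ n),
      mul_mul_mul_comm (starRingEnd ℂ (Complex.I ^ n)), hI, one_mul]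
  norm_cast
  have h1 := (sin_quasiEnergy_pos k).ne'
  have h2 := (sin_quasiEnergy_pos (k + u)).ne'
  rw [mul_sub (n : ℝ), Real.cos_sub, Real.cos_sub]
  field_simp
  ring

theorem meanOverlap_one (k u : ℝ) : meanOverlap 1 k u = Complex.cos u := by
  rw [meanOverlap_eq]
  have h1 := (sin_quasiEnergy_pos k).ne'
  have h2 := (sin_quasiEnergy_pos (k + u)).ne'
  simp only [Nat.cast_one, one_mul]
  rw [mul_div_cancel_left₀ _ (mul_ne_zero h1 h2)]
  push_cast
  ring

theorem meanOverlap_two (k u : ℝ) : meanOverlap 2 k u = Complex.cos u ^ 2 := by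
  unfold meanOverlap
  simp only [overlap, Function.iterate_succ, Function.iterate_zero, Function.comp_apply, id,
    Fin.sum_univ_two, momentumStep_zero, momentumStep_one, ket_apply,
    map_mul, map_add, map_sub, conj_inv_sqrt_two, conj_exp_mul_I,
    conj_exp_neg_mul_I, Complex.ofReal_add, add_mul (k : ℂ), neg_add,
    if_true, zero_ne_one, one_ne_zero, if_false, map_one, map_zero,
    Complex.exp_add, Complex.cos, neg_mul]
  have h1 := exp_mul_exp_neg (k * Complex.I)
  have h2 := exp_mul_exp_neg (u * Complex.I)
  have h3 := inv_sqrt_two_sq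
  generalize Complex.exp (k * Complex.I) = a at *
  generalize Complex.exp (-(k * Complex.I)) = a' at *
  generalize Complex.exp (u * Complex.I) = b at *
  generalize Complex.exp (-(u * Complex.I)) = b' at *
  generalize ((Real.sqrt 2 : ℝ) : ℂ)⁻¹ = s at *
  grind

/-! ### Characteristic functions of the limit laws -/

theorem charFun_pointMass (u : ℝ) : charFun (pointMass : Measure ℝ) u = 1 := by
  rw [charFun_apply_real, pointMass, ProbabilityMeasure.coe_mk, integral_dirac]
  simp

theorem charFun_stdNormal (u : ℝ) :
    charFun (stdNormal : Measure ℝ) u = Complex.exp (-(u ^ 2 / 2 : ℝ)) := by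
  rw [stdNormal, ProbabilityMeasure.coe_mk, charFun_gaussianReal]
  congr 1
  push_cast
  ring

theorem charFun_indepSum (μ ν : ProbabilityMeasure ℝ) (u : ℝ) :
    charFun (indepSum μ ν : Measure ℝ) u
      = charFun (μ : Measure ℝ) u * charFun (ν : Measure ℝ) u := by
  rw [← charFun_conv]
  -- The defining image measure is literally the convolution.
  rfl

/-- A law with density `ρ` is the image of the uniform law on `(-π/2, π/2)` under `h`. -/
theorem integral_density_eq {ρ h h' : ℝ → ℝ} (hρm : Measurable ρ) (hρ : ∀ x, 0 ≤ ρ x)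
    (hd : ∀ s ∈ Ioo (-(Real.pi / 2)) (Real.pi / 2), HasDerivAt h (h' s) s)
    (hpos : ∀ s ∈ Ioo (-(Real.pi / 2)) (Real.pi / 2), 0 < h' s)
    (hsupp : ∀ x, x ∉ h '' Ioo (-(Real.pi / 2)) (Real.pi / 2) → ρ x = 0)
    (hmul : ∀ s ∈ Ioo (-(Real.pi / 2)) (Real.pi / 2), h' s * ρ (h s) = Real.pi⁻¹)
    (f : ℝ → ℂ) :
    ∫ x, f x ∂(volume.withDensity fun x => ENNReal.ofReal (ρ x))
      = Real.pi⁻¹ * ∫ s in (-(Real.pi / 2))..(Real.pi / 2), f (h s) := by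
  have hinj : InjOn h (Ioo (-(Real.pi / 2)) (Real.pi / 2)) := by
    refine StrictMonoOn.injOn (strictMonoOn_of_deriv_pos (convex_Ioo _ _)
      (fun s hs => (hd s hs).continuousAt.continuousWithinAt) fun s hs => ?_)
    rw [interior_Ioo] at hs
    rw [(hd s hs).deriv]
    exact hpos s hs
  rw [integral_withDensity_eq_integral_toReal_smul (by fun_prop) (by simp)]
  simp only [ENNReal.toReal_ofReal (hρ _)]
  rw [← setIntegral_eq_integral_of_forall_compl_eq_zero
      (s := h '' Ioo (-(Real.pi / 2)) (Real.pi / 2)) fun x hx => by rw [hsupp x hx, zero_smul],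
    integral_image_eq_integral_abs_deriv_smul measurableSet_Ioo
      (fun s hs => (hd s hs).hasDerivWithinAt) hinj,
    intervalIntegral.integral_of_le (by linarith [Real.pi_pos]), integral_Ioc_eq_integral_Ioo,
    ← integral_const_mul]
  refine setIntegral_congr_fun measurableSet_Ioo fun s hs => ?_
  simp only [smul_smul]
  rw [abs_of_pos (hpos s hs), hmul s hs, Complex.real_smul]

theorem measurable_arcsineDensity : Measurable arcsineDensity := by
  unfold arcsineDensity
  exact Measurable.indicator (by fun_prop) measurableSet_Ioo

theorem measurable_konnoDensity : Measurable konnoDensity := by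
  unfold konnoDensity
  exact Measurable.indicator (by fun_prop) measurableSet_Ioo

theorem arcsineDensity_nonneg (x : ℝ) : 0 ≤ arcsineDensity x := by
  refine indicator_nonneg (fun x _ => ?_) x
  have := Real.pi_pos
  positivity

theorem inv_sqrt_two_sq_real : (1 / Real.sqrt 2) ^ 2 = (1 / 2 : ℝ) := by
  rw [div_pow, Real.sq_sqrt (by norm_num)]; norm_num

theorem konnoDensity_nonneg (x : ℝ) : 0 ≤ konnoDensity x := by
  refine indicator_nonneg (fun x hx => ?_) x
  have hx2 : x ^ 2 < 1 / 2 := by rw [← inv_sqrt_two_sq_real]; exact sq_lt_sq' hx.1 hx.2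
  have := Real.pi_pos
  have : 0 < 1 - x ^ 2 := by linarith
  positivity

theorem integral_arcsineLaw (β : ℝ) (f : ℝ → ℂ) :
    ∫ x, f x ∂(arcsineLaw β : Measure ℝ) = Real.pi⁻¹ *
      ∫ s in (-(Real.pi / 2))..(Real.pi / 2), f (Real.sin s / (2 : ℝ) ^ β) := by
  have hc : (0 : ℝ) < (2 : ℝ) ^ β := by positivity
  rw [arcsineLaw, ProbabilityMeasure.coe_mk]
  refine integral_density_eq (h' := fun s => Real.cos s / (2 : ℝ) ^ β)
    ((measurable_arcsineDensity.comp (measurable_const_mul _)).const_mul _)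
    (fun x => mul_nonneg hc.le (arcsineDensity_nonneg _))
    (fun s _ => (Real.hasDerivAt_sin s).div_const _)
    (fun s hs => div_pos (Real.cos_pos_of_mem_Ioo hs) hc) (fun x hx => ?_) (fun s hs => ?_) f
  · rw [Function.comp_apply, arcsineDensity, indicator_of_notMem, mul_zero]
    intro hm
    refine hx ⟨Real.arcsin ((2 : ℝ) ^ β * x),
      ⟨Real.neg_pi_div_two_lt_arcsin.2 hm.1, Real.arcsin_lt_pi_div_two.2 hm.2⟩, ?_⟩
    simp only
    rw [Real.sin_arcsin hm.1.le hm.2.le]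
    field_simp
  · have hcos := Real.cos_pos_of_mem_Ioo hs
    have hm : Real.sin s ∈ Ioo (-1 : ℝ) 1 := by
      rw [mem_Ioo, ← abs_lt, ← sq_lt_one_iff_abs_lt_one]
      nlinarith [Real.sin_sq_add_cos_sq s]
    rw [Function.comp_apply, mul_div_cancel₀ _ hc.ne', arcsineDensity, indicator_of_mem hm, ← Real.cos_sq',
      Real.sqrt_sq hcos.le]
    have := Real.pi_pos
    field_simp

/-- The substitution has inverse `sin s = x / √(1 - x²)` and is shaped like `groupVelocity` with
`sin s` in place of `cos k`, so that speeds at uniform momentum can be recognised. -/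
theorem integral_konnoLaw (f : ℝ → ℂ) :
    ∫ x, f x ∂(konnoLaw : Measure ℝ) = Real.pi⁻¹ *
      ∫ s in (-(Real.pi / 2))..(Real.pi / 2),
        f (Real.sin s / Real.sqrt (1 + Real.sin s ^ 2)) := by
  rw [konnoLaw, ProbabilityMeasure.coe_mk]
  have hpi := Real.pi_pos
  have hq : ∀ s, 0 < Real.sqrt (1 + Real.sin s ^ 2) := fun s => Real.sqrt_pos.2 (by positivity)
  have hqq : ∀ s, Real.sqrt (1 + Real.sin s ^ 2) ^ 2 = 1 + Real.sin s ^ 2 := fun s =>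
    Real.sq_sqrt (by positivity)
  refine integral_density_eq (h := fun s => Real.sin s / Real.sqrt (1 + Real.sin s ^ 2))
    (h' := fun s => Real.cos s / Real.sqrt (1 + Real.sin s ^ 2) ^ 3)
    measurable_konnoDensity konnoDensity_nonneg (fun s _ => ?_)
    (fun s hs => div_pos (Real.cos_pos_of_mem_Ioo hs) (pow_pos (hq s) 3))
    (fun x hx => ?_) (fun s hs => ?_) f
  · have h1 : HasDerivAt (fun s => 1 + Real.sin s ^ 2) (2 * Real.sin s * Real.cos s) s := by
      refine (((Real.hasDerivAt_sin s).pow 2).const_add 1).congr_deriv ?_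
      norm_num
    have h2 := (Real.hasDerivAt_sin s).div (h1.sqrt (by positivity)) (hq s).ne'
    refine h2.congr_deriv ?_
    have := hq s
    have h3 := hqq s
    set r := Real.sqrt (1 + Real.sin s ^ 2)
    field_simp
    rw [h3]
    ring
  · rw [konnoDensity, indicator_of_notMem]
    intro hm
    have hx2 : x ^ 2 < 1 / 2 := by rw [← inv_sqrt_two_sq_real]; exact sq_lt_sq' hm.1 hm.2
    have hr : 0 < Real.sqrt (1 - x ^ 2) := Real.sqrt_pos.2 (by linarith)
    have hrr : Real.sqrt (1 - x ^ 2) ^ 2 = 1 - x ^ 2 := Real.sq_sqrt (by linarith)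
    have hlt : |x / Real.sqrt (1 - x ^ 2)| < 1 := by
      rw [← sq_lt_one_iff_abs_lt_one, div_pow, hrr, div_lt_one (by linarith)]
      linarith
    rw [abs_lt] at hlt
    refine hx ⟨Real.arcsin (x / Real.sqrt (1 - x ^ 2)),
      ⟨Real.neg_pi_div_two_lt_arcsin.2 hlt.1, Real.arcsin_lt_pi_div_two.2 hlt.2⟩, ?_⟩
    simp only
    have e : 1 + (x / Real.sqrt (1 - x ^ 2)) ^ 2 = (1 / Real.sqrt (1 - x ^ 2)) ^ 2 := by
      rw [div_pow, div_pow, hrr]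
      have : 1 - x ^ 2 ≠ 0 := by linarith
      field_simp
      ring
    rw [Real.sin_arcsin hlt.1.le hlt.2.le, e, Real.sqrt_sq (by positivity)]
    field_simp
  · have hcos := Real.cos_pos_of_mem_Ioo hs
    have h1 := hq s
    have h2 := hqq s
    have hsc := Real.sin_sq_add_cos_sq s
    have e1 : 1 - (Real.sin s / Real.sqrt (1 + Real.sin s ^ 2)) ^ 2
        = 1 / Real.sqrt (1 + Real.sin s ^ 2) ^ 2 := by
      rw [div_pow, h2]
      have : 1 + Real.sin s ^ 2 ≠ 0 := by positivity
      field_simp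
      ring
    have e2 : 1 - 2 * (Real.sin s / Real.sqrt (1 + Real.sin s ^ 2)) ^ 2
        = (Real.cos s / Real.sqrt (1 + Real.sin s ^ 2)) ^ 2 := by
      rw [div_pow, div_pow, h2]
      have : 1 + Real.sin s ^ 2 ≠ 0 := by positivity
      field_simp
      linarith
    have hm : Real.sin s / Real.sqrt (1 + Real.sin s ^ 2)
        ∈ Ioo (-(1 / Real.sqrt 2)) (1 / Real.sqrt 2) := by
      rw [mem_Ioo, ← abs_lt]
      refine abs_lt_of_sq_lt_sq ?_ (by positivity)
      rw [inv_sqrt_two_sq_real]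
      have : 0 < (Real.cos s / Real.sqrt (1 + Real.sin s ^ 2)) ^ 2 := by positivity
      linarith
    rw [konnoDensity, indicator_of_mem hm, e1, e2, Real.sqrt_sq (by positivity)]
    field_simp

theorem charFun_indepMul (μ ν : ProbabilityMeasure ℝ) (u : ℝ) :
    charFun (indepMul μ ν : Measure ℝ) u = ∫ x, charFun (μ : Measure ℝ) (u * x) ∂(ν : Measure ℝ) := by
  rw [charFun_apply_real, indepMul, ProbabilityMeasure.coe_mk, integral_map (by fun_prop)
    (by fun_prop), integral_prod_symm]
  · simp only [charFun_apply_real]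
    refine integral_congr_ae (ae_of_all _ fun x => ?_)
    simp only
    refine integral_congr_ae (ae_of_all _ fun y => ?_)
    simp only
    push_cast
    ring_nf
  · refine Integrable.of_bound (C := 1) (by fun_prop) (ae_of_all _ fun x => ?_)
    rw [← Complex.ofReal_mul, Complex.norm_exp_ofReal_mul_I]

/-! ### Averages over the momentum -/

/-- Move the period to `[-π/2, 3π/2]`; the reflection `s ↦ π - s` exchanges its two halves. -/
theorem integral_comp_sin (G : ℝ → ℂ) (hG : Continuous G) :
    ∫ k in (-Real.pi)..Real.pi, G (Real.sin k)
      = 2 * ∫ s in (-(Real.pi / 2))..(Real.pi / 2), G (Real.sin s) := by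
  have hper : Function.Periodic (fun k => G (Real.sin k)) (2 * Real.pi) := fun k => by
    simp only [Real.sin_add_two_pi]
  have hc : Continuous fun k => G (Real.sin k) := by fun_prop
  have h1 := hper.intervalIntegral_add_eq (-Real.pi) (-(Real.pi / 2))
  rw [show -Real.pi + 2 * Real.pi = Real.pi by ring,
    show -(Real.pi / 2) + 2 * Real.pi = Real.pi + Real.pi / 2 by ring] at h1
  rw [h1, ← intervalIntegral.integral_add_adjacent_intervals (b := Real.pi / 2)
    (hc.intervalIntegrable _ _) (hc.intervalIntegrable _ _), two_mul]
  congr 1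
  have h2 := intervalIntegral.integral_comp_sub_left (fun k => G (Real.sin k)) Real.pi
    (a := -(Real.pi / 2)) (b := Real.pi / 2)
  simp only [Real.sin_pi_sub] at h2
  rw [h2]
  congr 1 <;> ring

theorem integral_comp_cos (G : ℝ → ℂ) (hG : Continuous G) :
    ∫ k in (-Real.pi)..Real.pi, G (Real.cos k)
      = 2 * ∫ s in (-(Real.pi / 2))..(Real.pi / 2), G (Real.sin s) := by
  have hper : Function.Periodic (fun k => G (Real.sin k)) (2 * Real.pi) := fun k => by
    simp only [Real.sin_add_two_pi]
  have h1 := hper.intervalIntegral_add_eq (-Real.pi) (-Real.pi + Real.pi / 2)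
  rw [show -Real.pi + 2 * Real.pi = Real.pi by ring,
    show -Real.pi + Real.pi / 2 + 2 * Real.pi = Real.pi + Real.pi / 2 by ring] at h1
  rw [← integral_comp_sin G hG, h1,
    ← intervalIntegral.integral_comp_add_right (fun k => G (Real.sin k))]
  simp only [Real.sin_add_pi_div_two]

theorem integral_comp_sin_two_mul (G : ℝ → ℂ) (hG : Continuous G) :
    ∫ k in (-Real.pi)..Real.pi, G (Real.sin (2 * k))
      = 2 * ∫ s in (-(Real.pi / 2))..(Real.pi / 2), G (Real.sin s) := by
  have hper : Function.Periodic (fun k => G (Real.sin k)) (2 * Real.pi) := fun k => by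
    simp only [Real.sin_add_two_pi]
  have hc : Continuous fun k => G (Real.sin k) := by fun_prop
  have h1 := hper.intervalIntegral_add_eq (-Real.pi) (-(2 * Real.pi))
  have h2 := hper.intervalIntegral_add_eq (-Real.pi) 0
  rw [show -Real.pi + 2 * Real.pi = Real.pi by ring] at h1 h2
  rw [neg_add_cancel] at h1
  rw [zero_add] at h2
  rw [intervalIntegral.integral_comp_mul_left (fun k => G (Real.sin k)) two_ne_zero, mul_neg,
    ← intervalIntegral.integral_add_adjacent_intervals (b := 0)
    (hc.intervalIntegrable _ _) (hc.intervalIntegrable _ _), ← h1, ← h2, integral_comp_sin G hG,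
    Complex.real_smul]
  push_cast
  ring

theorem mean_eq_charFun_arcsineLaw (β u : ℝ) :
    (2 * Real.pi)⁻¹ * ∫ k in (-Real.pi)..Real.pi,
        Complex.exp (-(Complex.I * (u / (2 : ℝ) ^ β : ℝ) * Real.sin (2 * k)))
      = charFun (arcsineLaw β : Measure ℝ) u := by
  rw [charFun_apply_real, integral_arcsineLaw, integral_comp_sin_two_mul
    (fun x => Complex.exp (-(Complex.I * (u / (2 : ℝ) ^ β : ℝ) * x))) (by fun_prop),
    ← mul_assoc]
  congr 1
  · push_cast; field_simp
  · have h := intervalIntegral.integral_comp_neg (a := -(Real.pi / 2)) (b := Real.pi / 2)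
      (fun s => Complex.exp (-(Complex.I * (u / (2 : ℝ) ^ β : ℝ) * Real.sin s)))
    rw [neg_neg] at h
    rw [← h]
    refine intervalIntegral.integral_congr fun s _ => ?_
    simp only [Real.sin_neg]
    congr 1
    push_cast
    ring

theorem continuous_div_sqrt_one_add_sq : Continuous fun x : ℝ => x / Real.sqrt (1 + x ^ 2) :=
  continuous_id.div (by fun_prop) fun x => (Real.sqrt_pos.2 (by positivity)).ne'

theorem mean_eq_charFun_normal_mul_konno (u : ℝ) :
    (2 * Real.pi)⁻¹ * ∫ k in (-Real.pi)..Real.pi,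
        Complex.exp (-((u * groupVelocity k) ^ 2 / 2 : ℝ))
      = charFun (indepMul stdNormal konnoLaw : Measure ℝ) u := by
  have hv := continuous_div_sqrt_one_add_sq
  rw [charFun_indepMul, integral_konnoLaw]
  simp only [charFun_stdNormal, groupVelocity]
  rw [integral_comp_cos
    (fun x => Complex.exp (-((u * (x / Real.sqrt (1 + x ^ 2))) ^ 2 / 2 : ℝ))) (by fun_prop),
    ← mul_assoc]
  congr 1
  push_cast; field_simp

/-- The law is symmetric, so its characteristic function is the half-sum of the integrals of
`exp(iux)` and `exp(-iux)`, that is, a cosine integral. -/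
theorem mean_eq_charFun_konnoLaw (u : ℝ) :
    (2 * Real.pi)⁻¹ * ∫ k in (-Real.pi)..Real.pi, (Real.cos (u * groupVelocity k) : ℂ)
      = charFun (konnoLaw : Measure ℝ) u := by
  have hv := continuous_div_sqrt_one_add_sq
  rw [charFun_apply_real, integral_konnoLaw]
  simp only [groupVelocity]
  rw [integral_comp_cos
    (fun x => (Real.cos (u * (x / Real.sqrt (1 + x ^ 2))) : ℂ)) (by fun_prop), ← mul_assoc]
  congr 1
  · push_cast; field_simp
  · have hv2 : Continuous fun s : ℝ => Real.sin s / Real.sqrt (1 + Real.sin s ^ 2) :=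
      hv.comp Real.continuous_sin
    have hv3 : Continuous fun s : ℝ => Real.sin (-s) / Real.sqrt (1 + Real.sin (-s) ^ 2) :=
      hv2.comp continuous_neg
    have h := intervalIntegral.integral_comp_neg (a := -(Real.pi / 2)) (b := Real.pi / 2)
      (fun s => Complex.exp (u * (Real.sin s / Real.sqrt (1 + Real.sin s ^ 2) : ℝ) * Complex.I))
    rw [neg_neg] at h
    have h2 : ∀ x : ℂ, x = 1 / 2 * (x + x) := fun x => by ring
    rw [h2 (∫ s in _.._, Complex.exp _)]
    nth_rewrite 1 [← h]
    rw [← intervalIntegral.integral_add ((by fun_prop : Continuous _).intervalIntegrable _ _)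
      ((by fun_prop : Continuous _).intervalIntegrable _ _),
      ← intervalIntegral.integral_const_mul]
    refine intervalIntegral.integral_congr fun s _ => ?_
    simp only [Real.sin_neg, neg_sq, Complex.ofReal_cos, Complex.cos]
    push_cast
    ring_nf

/-! ### Characteristic functions of the walks -/

theorem prod_ite_lt {M m : ℕ} (hm : m ≤ M) (a b : ℂ) :
    ∏ j : Fin M, (if (j : ℕ) < m then a else b) = a ^ m * b ^ (M - m) := by
  rw [Fin.prod_univ_eq_prod_range (fun j => if j < m then a else b) M,
    ← Finset.prod_range_mul_prod_Ico _ hm]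
  congr 1
  · rw [Finset.prod_congr rfl fun j hj => if_pos (Finset.mem_range.1 hj)]
    simp
  · rw [Finset.prod_congr rfl fun j hj => if_neg (Finset.mem_Ico.1 hj).1.not_gt]
    simp

theorem visits_two_mul {M j : ℕ} (hj : j < M) : visits M (2 * M) j = 2 := by
  have hM : 0 < M := by omega
  rw [visits_eq hM _ hj, Nat.mul_div_cancel _ hM, Nat.mul_mod_left]
  simp

theorem visits_add {M m j : ℕ} (hm : m ≤ M) (hj : j < M) :
    visits M (M + m) j = if j < m then 2 else 1 := by
  have hM : 0 < M := by omega
  rcases hm.eq_or_lt with rfl | hlt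
  · rw [← two_mul, visits_two_mul hj, if_pos hj]
  · rw [visits_eq hM _ hj, Nat.add_div_left _ hM, Nat.add_mod_left, Nat.div_eq_of_lt hlt,
      Nat.mod_eq_of_lt hlt]
    split_ifs <;> rfl

theorem latticeCharFun_pureLaw {M m : ℕ} [NeZero M] (hm : m ≤ M) (u : ℝ) :
    latticeCharFun (pureLaw M (M + m)) u = (2 * Real.pi)⁻¹ * ∫ k in (-Real.pi)..Real.pi,
      overlap 2 k u symQubit.1.ofLp ^ m * (Real.cos u : ℂ) ^ (M - m) := by
  rw [pureLaw, latticeCharFun_positionLaw]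
  congr 1
  refine intervalIntegral.integral_congr fun k _ => ?_
  simp only
  rw [← prod_ite_lt hm]
  refine Finset.prod_congr rfl fun j _ => ?_
  rw [visits_add hm j.2]
  split_ifs
  · rfl
  · rw [overlap_symQubit_one, Complex.ofReal_cos]

theorem latticeCharFun_mixedLaw {M m : ℕ} [NeZero M] (hm : m ≤ M) (u : ℝ) :
    latticeCharFun (mixedLaw M m (2 * M)) u = (2 * Real.pi)⁻¹ * ∫ k in (-Real.pi)..Real.pi,
      overlap 2 k u symQubit.1.ofLp ^ m * (Real.cos u : ℂ) ^ (2 * (M - m)) := by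
  rw [mixedLaw, latticeCharFun_uniform_bind
    (fun (j : Fin M) b => if M ≤ (j : ℕ) + m then symQubit else ket b)]
  congr 1
  refine intervalIntegral.integral_congr fun k _ => ?_
  simp only
  -- The `φ₀` coins have the `m` largest indices, so the threshold is `M - m` and the random coins
  -- come first.
  have h := prod_ite_lt (M.sub_le m) ((Real.cos u : ℂ) ^ 2) (overlap 2 k u symQubit.1.ofLp)
  rw [Nat.sub_sub_self hm] at h
  rw [pow_mul, mul_comm (overlap 2 k u symQubit.1.ofLp ^ m), ← h]
  refine Finset.prod_congr rfl fun j _ => ?_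
  rw [visits_two_mul j.2]
  by_cases hj : M ≤ (j : ℕ) + m
  · rw [if_neg (by omega)]
    simp only [if_pos hj, Fin.sum_univ_two]
    ring
  · rw [if_pos (by omega)]
    simp only [if_neg hj]
    rw [Complex.ofReal_cos]
    exact meanOverlap_two k u

theorem latticeCharFun_randomLaw {M : ℕ} [NeZero M] (t : ℕ) (u : ℝ) :
    latticeCharFun (randomLaw M t) u = (2 * Real.pi)⁻¹ * ∫ k in (-Real.pi)..Real.pi,
      meanOverlap (t / M + 1) k u ^ (t % M) * meanOverlap (t / M) k u ^ (M - t % M) := by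
  rw [randomLaw, latticeCharFun_uniform_bind (fun (_ : Fin M) b => ket b)]
  congr 1
  refine intervalIntegral.integral_congr fun k _ => ?_
  have hM := NeZero.pos M
  simp only
  rw [← prod_ite_lt (Nat.mod_lt t hM).le]
  refine Finset.prod_congr rfl fun j _ => ?_
  rw [visits_eq hM t j.2]
  split_ifs <;> rfl

/-! ### Limit lemmas -/

/-- `log z = (z - 1) · dslope`, with the slope at `1` tending to `1`. Using `dslope` covers indices
with `z n = 1`, which occur at `u = 0`. -/
theorem tendsto_mul_log {a : ℕ → ℝ} {z : ℕ → ℂ} {c : ℂ} (hz : Tendsto z atTop (𝓝 1))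
    (h : Tendsto (fun n => a n * (z n - 1)) atTop (𝓝 c)) :
    Tendsto (fun n => a n * Complex.log (z n)) atTop (𝓝 c) := by
  have hd : HasDerivAt Complex.log (1 : ℂ)⁻¹ 1 := Complex.hasDerivAt_log (by simp)
  have hc := (continuousAt_dslope_same.2 hd.differentiableAt).tendsto.comp hz
  rw [dslope_same, hd.deriv, inv_one] at hc
  have h2 := h.mul hc
  rw [mul_one] at h2
  refine h2.congr fun n => ?_
  have := sub_smul_dslope Complex.log 1 (z n)
  rw [Complex.log_one, sub_zero, smul_eq_mul] at this
  rw [← this, Function.comp_apply, mul_assoc]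

theorem tendsto_pow_exp {a : ℕ → ℕ} {z : ℕ → ℂ} {c : ℂ} (hz : Tendsto z atTop (𝓝 1))
    (h : Tendsto (fun n => ((a n : ℝ) : ℂ) * (z n - 1)) atTop (𝓝 c)) :
    Tendsto (fun n => z n ^ a n) atTop (𝓝 (Complex.exp c)) := by
  refine ((Complex.continuous_exp.tendsto c).comp (tendsto_mul_log hz h)).congr' ?_
  filter_upwards [hz.eventually_ne one_ne_zero] with n hn
  rw [Function.comp_apply, Complex.ofReal_natCast, Complex.exp_nat_mul, Complex.exp_log hn]

/-- The fraction `r / M` need not converge: `M log z` and `M log w` have the same limit, so the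
bounded weight `r / M` multiplies a difference tending to zero. It is needed because `t mod M` is
uncontrolled. -/
theorem tendsto_pow_mul_pow_exp {M r : ℕ → ℕ} {z w : ℕ → ℂ} {c : ℂ} (hr : ∀ n, r n ≤ M n)
    (hM : ∀ n, 0 < M n) (hz : Tendsto z atTop (𝓝 1)) (hw : Tendsto w atTop (𝓝 1))
    (hzc : Tendsto (fun n => ((M n : ℝ) : ℂ) * (z n - 1)) atTop (𝓝 c))
    (hwc : Tendsto (fun n => ((M n : ℝ) : ℂ) * (w n - 1)) atTop (𝓝 c)) :
    Tendsto (fun n => w n ^ r n * z n ^ (M n - r n)) atTop (𝓝 (Complex.exp c)) := by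
  have h1 := tendsto_mul_log hz hzc
  have h2 := tendsto_mul_log hw hwc
  have h3 : Tendsto (fun n => ((r n / M n : ℝ) : ℂ) * (((M n : ℝ) : ℂ) * Complex.log (w n)
      - ((M n : ℝ) : ℂ) * Complex.log (z n))) atTop (𝓝 0) := by
    have h4 := (h2.sub h1).norm
    rw [sub_self, norm_zero] at h4
    refine squeeze_zero_norm (fun n => ?_) h4
    rw [norm_mul, Complex.norm_real, Real.norm_of_nonneg (by positivity)]
    refine mul_le_of_le_one_left (norm_nonneg _) (div_le_one_of_le₀ ?_ (Nat.cast_nonneg _))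
    exact_mod_cast hr n
  have h5 := h1.add h3
  rw [add_zero] at h5
  refine ((Complex.continuous_exp.tendsto c).comp h5).congr' ?_
  filter_upwards [hz.eventually_ne one_ne_zero, hw.eventually_ne one_ne_zero] with n hzn hwn
  have hMn : (M n : ℂ) ≠ 0 := Nat.cast_ne_zero.2 (hM n).ne'
  rw [Function.comp_apply, ← Complex.exp_log hzn, ← Complex.exp_log hwn, ← Complex.exp_nat_mul,
    ← Complex.exp_nat_mul, ← Complex.exp_add, Nat.cast_sub (hr n), Complex.exp_log hzn,
    Complex.exp_log hwn]
  congr 1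
  push_cast
  field_simp
  ring

theorem tendsto_mul_cos_sub_one {a x : ℕ → ℝ} {s : ℝ} (hx : Tendsto x atTop (𝓝 0))
    (h : Tendsto (fun n => a n * x n ^ 2) atTop (𝓝 s)) :
    Tendsto (fun n => a n * (Real.cos (x n) - 1)) atTop (𝓝 (-(s / 2))) := by
  have hx2 : Tendsto (fun n => x n / 2) atTop (𝓝 0) := by simpa using hx.div_const 2
  have h1 := (Real.continuous_sinc.tendsto 0).comp hx2
  rw [Real.sinc_zero] at h1
  have h2 := (h.mul (h1.pow 2)).div_const (-2)
  have e : s * 1 ^ 2 / -2 = -(s / 2) := by ring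
  rw [e] at h2
  refine h2.congr fun n => ?_
  simp only [Function.comp_apply]
  have h3 : Real.cos (x n) = 1 - 2 * Real.sin (x n / 2) ^ 2 := by
    have := Real.cos_two_mul (x n / 2)
    rw [mul_div_cancel₀ _ two_ne_zero, Real.cos_sq'] at this
    rw [this]; ring
  rw [h3]
  rcases eq_or_ne (x n) 0 with h0 | h0
  · simp [h0]
  · rw [Real.sinc_of_ne_zero (div_ne_zero h0 two_ne_zero)]
    field_simp
    ring

theorem tendsto_mul_sin {a x : ℕ → ℝ} {s : ℝ} (hx : Tendsto x atTop (𝓝 0))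
    (h : Tendsto (fun n => a n * x n) atTop (𝓝 s)) :
    Tendsto (fun n => a n * Real.sin (x n)) atTop (𝓝 s) := by
  have h1 := (Real.continuous_sinc.tendsto 0).comp hx
  rw [Real.sinc_zero] at h1
  have h2 := h.mul h1
  rw [mul_one] at h2
  refine h2.congr fun n => ?_
  simp only [Function.comp_apply]
  rcases eq_or_ne (x n) 0 with h0 | h0
  · simp [h0]
  · rw [Real.sinc_of_ne_zero h0]
    field_simp

theorem tendsto_mean {F : ℕ → ℝ → ℂ} {f : ℝ → ℂ} (hc : ∀ n, Continuous (F n))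
    (hb : ∀ n k, ‖F n k‖ ≤ 1) (h : ∀ k, Tendsto (fun n => F n k) atTop (𝓝 (f k))) :
    Tendsto (fun n => ((2 * Real.pi)⁻¹ : ℝ) * ∫ k in (-Real.pi)..Real.pi, F n k) atTop
      (𝓝 (((2 * Real.pi)⁻¹ : ℝ) * ∫ k in (-Real.pi)..Real.pi, f k)) := by
  refine Tendsto.const_mul _ ?_
  exact intervalIntegral.tendsto_integral_filter_of_dominated_convergence (fun _ => 1)
    (Eventually.of_forall fun n => (hc n).aestronglyMeasurable)
    (Eventually.of_forall fun n => ae_of_all _ fun k _ => hb n k)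
    intervalIntegrable_const (ae_of_all _ fun k _ => h k)

/-- The overlap minus one is `-sin² u - i sin u sin(2k+u)`. Multiplied by `m ~ l / u`, its real part
vanishes in the limit and only the phase survives. -/
theorem tendsto_overlap_symQubit_pow {m : ℕ → ℕ} {u : ℕ → ℝ} {l : ℝ}
    (hu : Tendsto u atTop (𝓝 0)) (hl : Tendsto (fun n => m n * u n) atTop (𝓝 l)) (k : ℝ) :
    Tendsto (fun n => overlap 2 k (u n) symQubit.1.ofLp ^ m n) atTop
      (𝓝 (Complex.exp (-(Complex.I * l * Real.sin (2 * k))))) := by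
  have hsin : Tendsto (fun n => Real.sin (u n)) atTop (𝓝 0) := by
    have := (Real.continuous_sin.tendsto 0).comp hu
    rwa [Real.sin_zero] at this
  have hsk : Tendsto (fun n => Real.sin (2 * k + u n)) atTop (𝓝 (Real.sin (2 * k))) := by
    have := (Real.continuous_sin.tendsto (2 * k + 0)).comp (hu.const_add (2 * k))
    rwa [add_zero] at this
  have e : ∀ n, overlap 2 k (u n) symQubit.1.ofLp - 1 = ((-(Real.sin (u n) * Real.sin (u n)) : ℝ) : ℂ)
      - Complex.I * ((Real.sin (u n) * Real.sin (2 * k + u n) : ℝ) : ℂ) := by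
    intro n
    rw [overlap_symQubit_two, Complex.cos_sq']
    push_cast
    ring
  refine tendsto_pow_exp ?_ ?_
  · have h1 := ((hsin.mul hsin).neg.ofReal).sub ((hsin.mul hsk).ofReal.const_mul Complex.I)
    have h2 := h1.add_const 1
    simp only [← e] at h2
    simpa using h2
  · simp only [e]
    have hms := tendsto_mul_sin hu hl
    have h1 := ((hms.mul hsin).neg.ofReal).sub ((hms.mul hsk).ofReal.const_mul Complex.I)
    convert h1 using 2
    · push_cast; ring
    · push_cast; ring

theorem tendsto_cos_pow {a : ℕ → ℕ} {u : ℕ → ℝ} {s : ℝ} (hu : Tendsto u atTop (𝓝 0))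
    (hs : Tendsto (fun n => a n * u n ^ 2) atTop (𝓝 s)) :
    Tendsto (fun n => (Real.cos (u n) : ℂ) ^ a n) atTop (𝓝 (Complex.exp (-(s / 2 : ℝ)))) := by
  refine tendsto_pow_exp ?_ ?_
  · have := ((Real.continuous_cos.tendsto 0).comp hu).ofReal
    simpa using this
  · have := (tendsto_mul_cos_sub_one hu hs).ofReal
    convert this using 2
    · push_cast; ring
    · push_cast; ring

theorem tendsto_mean_symQubit {a m : ℕ → ℕ} {u : ℕ → ℝ} {s l : ℝ}
    (hu : Tendsto u atTop (𝓝 0)) (hs : Tendsto (fun n => a n * u n ^ 2) atTop (𝓝 s))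
    (hl : Tendsto (fun n => m n * u n) atTop (𝓝 l)) :
    Tendsto (fun n => ((2 * Real.pi)⁻¹ : ℝ) * ∫ k in (-Real.pi)..Real.pi,
      overlap 2 k (u n) symQubit.1.ofLp ^ m n * (Real.cos (u n) : ℂ) ^ a n) atTop
      (𝓝 (Complex.exp (-(s / 2 : ℝ)) * (((2 * Real.pi)⁻¹ : ℝ) * ∫ k in (-Real.pi)..Real.pi,
        Complex.exp (-(Complex.I * l * Real.sin (2 * k)))))) := by
  rw [mul_left_comm, ← intervalIntegral.integral_const_mul]
  refine tendsto_mean (fun n => ?_) (fun n k => ?_) fun k => ?_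
  · have := continuous_overlap 2 (u n) symQubit.1.ofLp
    fun_prop
  · rw [norm_mul, norm_pow, norm_pow, Complex.norm_real]
    exact mul_le_one₀ (pow_le_one₀ (norm_nonneg _) (norm_overlap_le _ _ _ _)) (by positivity)
      (pow_le_one₀ (norm_nonneg _) (Real.abs_cos_le_one _))
  · rw [mul_comm (Complex.exp _)]
    exact (tendsto_overlap_symQubit_pow hu hl k).mul (tendsto_cos_pow hu hs)

theorem exists_slope_quasiEnergy {u : ℕ → ℝ} (hu : Tendsto u atTop (𝓝 0)) (k : ℝ) :
    ∃ q : ℕ → ℝ, Tendsto q atTop (𝓝 (-groupVelocity k)) ∧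
      ∀ n, quasiEnergy (k + u n) - quasiEnergy k = u n * q n := by
  have hd := hasDerivAt_quasiEnergy k
  refine ⟨fun n => dslope quasiEnergy k (k + u n), ?_, fun n => ?_⟩
  · have hku : Tendsto (fun n => k + u n) atTop (𝓝 k) := by simpa using hu.const_add k
    have hc := (continuousAt_dslope_same.2 hd.differentiableAt).tendsto.comp hku
    rwa [dslope_same, hd.deriv] at hc
  · rw [← sub_smul_dslope, smul_eq_mul, add_sub_cancel_left]

/-- The correction in `meanOverlap_eq` is at most `2 |cos u - cos(ω(k+u) - ω(k))|` whatever the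
number `e` of visits, and this is `O(u²)` because `ω` is differentiable at `k`. -/
theorem tendsto_mul_meanOverlap_sub_cos {a u : ℕ → ℝ} (e : ℕ → ℕ) (hu : Tendsto u atTop (𝓝 0))
    (ha : Tendsto (fun n => a n * u n ^ 2) atTop (𝓝 0)) (k : ℝ) :
    Tendsto (fun n => (a n : ℂ) * (meanOverlap (e n) k (u n)
      - Real.cos (e n * (quasiEnergy (k + u n) - quasiEnergy k)))) atTop (𝓝 0) := by
  obtain ⟨q, hq, hδ⟩ := exists_slope_quasiEnergy hu k
  have h1 := tendsto_mul_cos_sub_one hu ha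
  have h2 : Tendsto (fun n => a n * (Real.cos (u n * q n) - 1)) atTop (𝓝 (-(0 / 2))) := by
    refine tendsto_mul_cos_sub_one (by simpa using hu.mul hq) ?_
    have := ha.mul (hq.pow 2)
    rw [zero_mul] at this
    exact this.congr fun n => by ring
  have h3 := ((h1.sub h2).norm.const_mul 2)
  rw [sub_self, norm_zero, mul_zero] at h3
  refine squeeze_zero_norm (fun n => ?_) h3
  rw [meanOverlap_eq, ← Complex.ofReal_sub, ← Complex.ofReal_mul, Complex.norm_real,
    add_sub_cancel_left, hδ]
  have hss := half_le_sin_mul_sin_quasiEnergy k (k + u n)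
  have e1 : a n * (Real.cos (u n) - 1) - a n * (Real.cos (u n * q n) - 1)
      = a n * (Real.cos (u n) - Real.cos (u n * q n)) := by ring
  rw [e1, norm_mul, norm_mul, mul_left_comm]
  refine mul_le_mul_of_nonneg_left ?_ (norm_nonneg _)
  rw [norm_div, norm_mul, norm_mul, Real.norm_of_nonneg (le_trans (by norm_num) hss),
    div_le_iff₀ (by linarith)]
  have hA : ‖Real.sin (e n * quasiEnergy k)‖ * ‖Real.sin (e n * quasiEnergy (k + u n))‖ ≤ 1 :=
    mul_le_one₀ (Real.abs_sin_le_one _) (norm_nonneg _) (Real.abs_sin_le_one _)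
  have hD := norm_nonneg (Real.cos (u n) - Real.cos (u n * q n))
  nlinarith [mul_le_mul_of_nonneg_right hA hD, mul_le_mul_of_nonneg_left hss hD]

theorem tendsto_mul_meanOverlap_sub_one {a u : ℕ → ℝ} {e : ℕ → ℕ} {L : ℝ}
    (hu : Tendsto u atTop (𝓝 0)) (ha : Tendsto (fun n => a n * u n ^ 2) atTop (𝓝 0))
    (he : Tendsto (fun n => e n * u n) atTop (𝓝 0))
    (hL : Tendsto (fun n => a n * (e n * u n) ^ 2) atTop (𝓝 (L ^ 2))) (k : ℝ) :
    Tendsto (fun n => (a n : ℂ) * (meanOverlap (e n) k (u n) - 1)) atTop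
      (𝓝 (-((L * groupVelocity k) ^ 2 / 2 : ℝ))) := by
  obtain ⟨q, hq, hδ⟩ := exists_slope_quasiEnergy hu k
  have h1 := tendsto_mul_meanOverlap_sub_cos e hu ha k
  have h2 : Tendsto (fun n => a n * (Real.cos (e n * (u n * q n)) - 1)) atTop
      (𝓝 (-((L * groupVelocity k) ^ 2 / 2))) := by
    refine tendsto_mul_cos_sub_one ?_ ?_
    · have := he.mul hq
      rw [zero_mul] at this
      exact this.congr fun n => by ring
    · have := hL.mul (hq.pow 2)
      rw [neg_sq, ← mul_pow] at this
      exact this.congr fun n => by ring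
  have h3 := h1.add h2.ofReal
  rw [zero_add, Complex.ofReal_neg] at h3
  refine h3.congr fun n => ?_
  rw [hδ]
  push_cast
  ring

theorem tendsto_meanOverlap_one {u : ℕ → ℝ} {e : ℕ → ℕ} (hu : Tendsto u atTop (𝓝 0))
    (he : Tendsto (fun n => e n * u n) atTop (𝓝 0)) (k : ℝ) :
    Tendsto (fun n => meanOverlap (e n) k (u n)) atTop (𝓝 1) := by
  -- With a constant weight and `L = 0` the rescaled limit is plain convergence to `1`.
  have h := tendsto_mul_meanOverlap_sub_one (a := fun _ => 1) (L := 0) hu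
    (by simpa using hu.pow 2) he (by simpa using he.pow 2) k
  have h2 := h.add_const 1
  simpa using h2

theorem norm_pow_mul_pow_meanOverlap_le (d e a b : ℕ) (k u : ℝ) :
    ‖meanOverlap d k u ^ a * meanOverlap e k u ^ b‖ ≤ 1 := by
  rw [norm_mul, norm_pow, norm_pow]
  exact mul_le_one₀ (pow_le_one₀ (norm_nonneg _) (norm_meanOverlap_le _ _ _)) (by positivity)
    (pow_le_one₀ (norm_nonneg _) (norm_meanOverlap_le _ _ _))

/-- Each coin is visited `d` or `d + 1` times with `d = ⌊t/M⌋`; `h0` and `h1` make both visit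
numbers yield the same exponent. -/
theorem tendsto_latticeCharFun_randomLaw {t M : ℕ → ℕ} [∀ n, NeZero (M n)] {u : ℕ → ℝ} {L : ℝ}
    (hu : Tendsto u atTop (𝓝 0)) (hM : Tendsto (fun n => M n * u n ^ 2) atTop (𝓝 0))
    (hd : Tendsto (fun n => (t n / M n : ℕ) * u n) atTop (𝓝 0))
    (h0 : Tendsto (fun n => M n * ((t n / M n : ℕ) * u n) ^ 2) atTop (𝓝 (L ^ 2)))
    (h1 : Tendsto (fun n => M n * ((t n / M n + 1 : ℕ) * u n) ^ 2) atTop (𝓝 (L ^ 2))) :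
    Tendsto (fun n => latticeCharFun (randomLaw (M n) (t n)) (u n)) atTop
      (𝓝 (((2 * Real.pi)⁻¹ : ℝ) * ∫ k in (-Real.pi)..Real.pi,
        Complex.exp (-((L * groupVelocity k) ^ 2 / 2 : ℝ)))) := by
  simp only [latticeCharFun_randomLaw]
  have hd1 : Tendsto (fun n => (t n / M n + 1 : ℕ) * u n) atTop (𝓝 0) := by
    have := hd.add hu
    rw [add_zero] at this
    exact this.congr fun n => by push_cast; ring
  refine tendsto_mean (fun n => ?_) (fun n k => norm_pow_mul_pow_meanOverlap_le _ _ _ _ _ _)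
    fun k => ?_
  · have := fun e => continuous_meanOverlap e (u n)
    fun_prop
  · exact tendsto_pow_mul_pow_exp (fun n => (Nat.mod_lt _ (NeZero.pos (M n))).le)
      (fun n => NeZero.pos (M n)) (tendsto_meanOverlap_one hu hd k)
      (tendsto_meanOverlap_one hu hd1 k) (tendsto_mul_meanOverlap_sub_one hu hM hd h0 k)
      (tendsto_mul_meanOverlap_sub_one hu hM hd1 h1 k)

theorem tendsto_latticeCharFun_randomLaw_one {t : ℕ → ℕ} {u : ℕ → ℝ} {L : ℝ}
    (hu : Tendsto u atTop (𝓝 0)) (hL : Tendsto (fun n => t n * u n) atTop (𝓝 L)) :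
    Tendsto (fun n => latticeCharFun (randomLaw 1 (t n)) (u n)) atTop
      (𝓝 (((2 * Real.pi)⁻¹ : ℝ) * ∫ k in (-Real.pi)..Real.pi,
        (Real.cos (L * groupVelocity k) : ℂ))) := by
  simp only [latticeCharFun_randomLaw, Nat.div_one, Nat.mod_one, Nat.sub_zero]
  refine tendsto_mean (fun n => ?_) (fun n k => norm_pow_mul_pow_meanOverlap_le _ _ _ _ _ _)
    fun k => ?_
  · have := fun e => continuous_meanOverlap e (u n)
    fun_prop
  · obtain ⟨q, hq, hδ⟩ := exists_slope_quasiEnergy hu k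
    have h1 := tendsto_mul_meanOverlap_sub_cos (a := fun _ => 1) t hu (by simpa using hu.pow 2) k
    have h2 : Tendsto (fun n => Real.cos (t n * (u n * q n))) atTop
        (𝓝 (Real.cos (L * groupVelocity k))) := by
      have := (Real.continuous_cos.tendsto _).comp (hL.mul hq)
      rw [mul_neg, Real.cos_neg] at this
      exact this.congr fun n => by rw [Function.comp_apply, mul_assoc]
    have h3 := h1.add h2.ofReal
    rw [zero_add] at h3
    refine h3.congr fun n => ?_
    rw [hδ]
    push_cast
    ring

/-- With one or two visits per coin the averaged overlap is `cos u` to the number of visits,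
independently of `k`, and the visits add up to `t`. -/
theorem latticeCharFun_randomLaw_of_div_eq_one {M t : ℕ} [NeZero M] (h : t / M = 1) (u : ℝ) :
    latticeCharFun (randomLaw M t) u = (Real.cos u : ℂ) ^ t := by
  have hM := NeZero.pos M
  have ht : t = M + t % M := by
    have := Nat.div_add_mod t M
    rw [h, mul_one] at this
    exact this.symm
  have hr := Nat.mod_lt t hM
  rw [latticeCharFun_randomLaw, h]
  simp only [meanOverlap_one, one_add_one_eq_two, meanOverlap_two]
  rw [← pow_mul, ← pow_add, show 2 * (t % M) + (M - t % M) = t by omega]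
  rw [intervalIntegral.integral_const, Complex.real_smul, Complex.ofReal_cos, ← mul_assoc,
    ← Complex.ofReal_mul]
  have : (2 * Real.pi)⁻¹ * (Real.pi - -Real.pi) = 1 := by
    have := Real.pi_ne_zero
    field_simp
    ring
  rw [this]
  simp

/-! ### Asymptotics of powers -/

/-- Passage from the reference scale `x` to the time `t ~ κ x`: the last factor decays when `α < θ`
and is `1` when `α = θ`. -/
theorem div_rpow_eventuallyEq {f x t : ℕ → ℝ} {κ : ℝ} (α θ : ℝ) (hx : Tendsto x atTop atTop)
    (ht : Tendsto (fun n => t n / x n) atTop (𝓝 κ)) (hκ : 0 < κ) :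
    (fun n => f n / x n ^ α * (t n / x n) ^ (-θ) * x n ^ (-(θ - α)))
      =ᶠ[atTop] fun n => f n / t n ^ θ := by
  filter_upwards [hx.eventually_gt_atTop 0, ht.eventually (lt_mem_nhds hκ)] with n hxn htn
  have hpos : 0 < t n := by
    have := mul_pos htn hxn
    rwa [div_mul_cancel₀ _ hxn.ne'] at this
  rw [Real.div_rpow hpos.le hxn.le, neg_sub, Real.rpow_sub hxn, Real.rpow_neg hpos.le,
    Real.rpow_neg hxn.le]
  have h1 := (Real.rpow_pos_of_pos hxn θ).ne'
  have h2 := (Real.rpow_pos_of_pos hxn α).ne'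
  have h3 := (Real.rpow_pos_of_pos hpos θ).ne'
  field_simp

theorem tendsto_div_rpow_of_lt {f x t : ℕ → ℝ} {α θ c κ : ℝ} (hx : Tendsto x atTop atTop)
    (ht : Tendsto (fun n => t n / x n) atTop (𝓝 κ)) (hκ : 0 < κ)
    (hf : Tendsto (fun n => f n / x n ^ α) atTop (𝓝 c)) (h : α < θ) :
    Tendsto (fun n => f n / t n ^ θ) atTop (𝓝 0) := by
  refine Tendsto.congr' (div_rpow_eventuallyEq α θ hx ht hκ) ?_
  have h1 := (hf.mul (ht.rpow_const (p := -θ) (Or.inl hκ.ne'))).mul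
    ((tendsto_rpow_neg_atTop (sub_pos.2 h)).comp hx)
  rwa [mul_zero] at h1

theorem tendsto_div_rpow_of_eq {f x t : ℕ → ℝ} {θ c κ : ℝ} (hx : Tendsto x atTop atTop)
    (ht : Tendsto (fun n => t n / x n) atTop (𝓝 κ)) (hκ : 0 < κ)
    (hf : Tendsto (fun n => f n / x n ^ θ) atTop (𝓝 c)) :
    Tendsto (fun n => f n / t n ^ θ) atTop (𝓝 (c * κ ^ (-θ))) := by
  refine Tendsto.congr' (div_rpow_eventuallyEq θ θ hx ht hκ) ?_
  simp only [sub_self, neg_zero, Real.rpow_zero, mul_one]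
  exact hf.mul (ht.rpow_const (Or.inl hκ.ne'))

theorem tendsto_div_self_one {x : ℕ → ℝ} (hx : Tendsto x atTop atTop) :
    Tendsto (fun n => x n / x n) atTop (𝓝 1) := by
  refine Tendsto.congr' ?_ tendsto_const_nhds
  filter_upwards [hx.eventually_gt_atTop 0] with n hn
  rw [div_self hn.ne']

theorem tendsto_const_div_rpow {x : ℕ → ℝ} {θ : ℝ} (u : ℝ) (hx : Tendsto x atTop atTop)
    (hθ : 0 < θ) : Tendsto (fun n => u / x n ^ θ) atTop (𝓝 0) :=
  ((tendsto_rpow_atTop hθ).comp hx).const_div_atTop u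

theorem tendsto_atTop_of_div {x t : ℕ → ℝ} {κ : ℝ} (hx : Tendsto x atTop atTop)
    (ht : Tendsto (fun n => t n / x n) atTop (𝓝 κ)) (hκ : 0 < κ) : Tendsto t atTop atTop := by
  refine Tendsto.congr' ?_ (ht.pos_mul_atTop hκ hx)
  filter_upwards [hx.eventually_gt_atTop 0] with n hn
  rw [div_mul_cancel₀ _ hn.ne']

theorem rpow_two_mul {y : ℝ} (hy : 0 ≤ y) (θ : ℝ) : y ^ (2 * θ) = (y ^ θ) ^ 2 := by
  rw [mul_comm, Real.rpow_mul hy, Real.rpow_two]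

/-! ### Weak limits -/

theorem tendsto_rescaled {p : ℕ → PMF ℤ} {t : ℕ → ℕ} {θ : ℝ} {μ : ProbabilityMeasure ℝ}
    (h : ∀ u, Tendsto (fun n => latticeCharFun (p n) (u / (t n : ℝ) ^ θ)) atTop
      (𝓝 (charFun (μ : Measure ℝ) u))) :
    Tendsto (fun n => rescaled (p n) (t n) θ) atTop (𝓝 μ) := by
  refine ProbabilityMeasure.tendsto_iff_tendsto_charFun.2 fun u => ?_
  simp only [charFun_rescaled]
  exact h u

theorem mean_zero_eq_one :
    ((2 * Real.pi)⁻¹ : ℝ) * ∫ k in (-Real.pi)..Real.pi,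
      Complex.exp (-(Complex.I * (0 : ℝ) * Real.sin (2 * k))) = 1 := by
  have h : ((2 * Real.pi)⁻¹ * (Real.pi - -Real.pi) : ℝ) = 1 := by
    have := Real.pi_ne_zero
    field_simp
    ring
  simp only [Complex.ofReal_zero, mul_zero, zero_mul, neg_zero, Complex.exp_zero]
  rw [intervalIntegral.integral_const, Complex.real_smul, mul_one, ← Complex.ofReal_mul, h,
    Complex.ofReal_one]

/-! ### Limits when `m` coins start from `φ₀` and are visited twice -/

section SymQubit

variable {p : ℕ → PMF ℤ} {t a m : ℕ → ℕ} {x : ℕ → ℝ} {β θ κ c : ℝ}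

/-- The first two regimes differ only through two numbers: `σ`, the variance of the Gaussian part,
and `l`, the size of the arcsine part. -/
theorem tendsto_rescaled_of_symQubit {σ l : ℝ} {μ : ProbabilityMeasure ℝ}
    (hp : ∀ n v, latticeCharFun (p n) v = (2 * Real.pi)⁻¹ * ∫ k in (-Real.pi)..Real.pi,
      overlap 2 k v symQubit.1.ofLp ^ m n * (Real.cos v : ℂ) ^ a n)
    (ht : Tendsto (fun n => (t n : ℝ)) atTop atTop) (hθ : 0 < θ)
    (hσ : Tendsto (fun n => (a n : ℝ) / (t n : ℝ) ^ (2 * θ)) atTop (𝓝 σ))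
    (hl : Tendsto (fun n => (m n : ℝ) / (t n : ℝ) ^ θ) atTop (𝓝 l))
    (hμ : ∀ u, charFun (μ : Measure ℝ) u = Complex.exp (-(u ^ 2 * σ / 2 : ℝ))
      * (((2 * Real.pi)⁻¹ : ℝ) * ∫ k in (-Real.pi)..Real.pi,
        Complex.exp (-(Complex.I * (u * l : ℝ) * Real.sin (2 * k))))) :
    Tendsto (fun n => rescaled (p n) (t n) θ) atTop (𝓝 μ) := by
  refine tendsto_rescaled fun u => ?_
  rw [hμ]
  simp only [hp]
  refine tendsto_mean_symQubit (tendsto_const_div_rpow u ht hθ) ?_ ?_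
  · refine (hσ.const_mul (u ^ 2)).congr fun n => ?_
    rw [rpow_two_mul (Nat.cast_nonneg _), div_pow]
    ring
  · exact (hl.const_mul u).congr fun n => by ring

variable (hp : ∀ n v, latticeCharFun (p n) v = (2 * Real.pi)⁻¹ * ∫ k in (-Real.pi)..Real.pi,
      overlap 2 k v symQubit.1.ofLp ^ m n * (Real.cos v : ℂ) ^ a n)
    (hx : Tendsto x atTop atTop) (hκ : 0 < κ)
    (ht : Tendsto (fun n => (t n : ℝ) / x n) atTop (𝓝 κ))
    (ha : Tendsto (fun n => (a n : ℝ) / x n) atTop (𝓝 c))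
    (hm : Tendsto (fun n => (m n : ℝ) / x n ^ β) atTop (𝓝 1))

include hp hx hκ ht ha hm

theorem tendsto_pointMass_of_symQubit (h : max (1 / 2) β < θ) :
    Tendsto (fun n => rescaled (p n) (t n) θ) atTop (𝓝 pointMass) := by
  obtain ⟨h1, h2⟩ := max_lt_iff.1 h
  refine tendsto_rescaled_of_symQubit hp (tendsto_atTop_of_div hx ht hκ) (by linarith)
    (tendsto_div_rpow_of_lt (α := 1) hx ht hκ (by simpa using ha) (by linarith))
    (tendsto_div_rpow_of_lt hx ht hκ hm h2) fun u => ?_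
  rw [charFun_pointMass, mul_zero, mul_zero, mean_zero_eq_one]
  simp

theorem tendsto_stdNormal_of_symQubit (hθ : θ = 1 / 2) (hβ : β < 1 / 2) (hc : c = κ) :
    Tendsto (fun n => rescaled (p n) (t n) θ) atTop (𝓝 stdNormal) := by
  have h2 : 2 * θ = 1 := by linarith
  refine tendsto_rescaled_of_symQubit hp (tendsto_atTop_of_div hx ht hκ) (by linarith)
    (tendsto_div_rpow_of_eq hx ht hκ (by simpa [h2] using ha))
    (tendsto_div_rpow_of_lt hx ht hκ hm (by linarith)) fun u => ?_
  rw [charFun_stdNormal, mul_zero, mean_zero_eq_one, h2, hc, Real.rpow_neg_one,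
    mul_inv_cancel₀ hκ.ne', mul_one, mul_one]

/-- The arcsine parameter `b` records the change from the scale `x` of `m` to the time `t ~ κ x`: `κ
= 1` gives `b = 0`, and `κ = 2` gives `b = 1/2`. -/
theorem tendsto_indepSum_of_symQubit {b : ℝ} (hθ : θ = 1 / 2) (hβ : β = 1 / 2) (hc : c = κ)
    (hb : κ ^ (-(1 / 2 : ℝ)) = ((2 : ℝ) ^ b)⁻¹) :
    Tendsto (fun n => rescaled (p n) (t n) θ) atTop (𝓝 (indepSum stdNormal (arcsineLaw b))) := by
  have h2 : 2 * θ = 1 := by linarith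
  subst hθ hβ
  refine tendsto_rescaled_of_symQubit hp (tendsto_atTop_of_div hx ht hκ) (by norm_num)
    (tendsto_div_rpow_of_eq hx ht hκ (by simpa using ha))
    (tendsto_div_rpow_of_eq hx ht hκ hm) fun u => ?_
  rw [charFun_indepSum, charFun_stdNormal, ← mean_eq_charFun_arcsineLaw, h2, hc,
    Real.rpow_neg_one, mul_inv_cancel₀ hκ.ne', mul_one, one_mul, hb, ← div_eq_mul_inv]

theorem tendsto_arcsineLaw_of_symQubit {b : ℝ} (hθ : θ = β) (hβ : 1 / 2 < β)
    (hb : κ ^ (-β) = ((2 : ℝ) ^ b)⁻¹) :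
    Tendsto (fun n => rescaled (p n) (t n) θ) atTop (𝓝 (arcsineLaw b)) := by
  subst hθ
  refine tendsto_rescaled_of_symQubit hp (tendsto_atTop_of_div hx ht hκ) (by linarith)
    (tendsto_div_rpow_of_lt (α := 1) hx ht hκ (by simpa using ha) (by linarith))
    (tendsto_div_rpow_of_eq hx ht hκ hm) fun u => ?_
  rw [← mean_eq_charFun_arcsineLaw, one_mul, hb, ← div_eq_mul_inv, mul_zero]
  simp

end SymQubit

theorem tendsto_div_of_lt_one {M m : ℕ → ℕ} {β : ℝ} (hM : Tendsto M atTop atTop)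
    (hm : Tendsto (fun n => (m n : ℝ) / (M n : ℝ) ^ β) atTop (𝓝 1)) (hβ : β < 1) :
    Tendsto (fun n => (m n : ℝ) / (M n : ℝ)) atTop (𝓝 0) := by
  have hx : Tendsto (fun n => (M n : ℝ)) atTop atTop := tendsto_natCast_atTop_atTop.comp hM
  simpa using tendsto_div_rpow_of_lt hx (tendsto_div_self_one hx) one_pos hm hβ

theorem tendsto_sub_div {M m : ℕ → ℕ} {l : ℝ} (hM : Tendsto M atTop atTop) (hm : ∀ n, m n ≤ M n)
    (hl : Tendsto (fun n => (m n : ℝ) / (M n : ℝ)) atTop (𝓝 l)) :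
    Tendsto (fun n => ((M n - m n : ℕ) : ℝ) / (M n : ℝ)) atTop (𝓝 (1 - l)) := by
  have hx : Tendsto (fun n => (M n : ℝ)) atTop atTop := tendsto_natCast_atTop_atTop.comp hM
  refine ((tendsto_div_self_one hx).sub hl).congr fun n => ?_
  rw [Nat.cast_sub (hm n), sub_div]

theorem tendsto_add_div {M m : ℕ → ℕ} {l : ℝ} (hM : Tendsto M atTop atTop)
    (hl : Tendsto (fun n => (m n : ℝ) / (M n : ℝ)) atTop (𝓝 l)) :
    Tendsto (fun n => ((M n + m n : ℕ) : ℝ) / (M n : ℝ)) atTop (𝓝 (1 + l)) := by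
  have hx : Tendsto (fun n => (M n : ℝ)) atTop atTop := tendsto_natCast_atTop_atTop.comp hM
  refine ((tendsto_div_self_one hx).add hl).congr fun n => ?_
  rw [Nat.cast_add, add_div]

theorem pureLaw_limits {β θ : ℝ} (hβ : β ≤ 1) (hθ : θ ≤ 1) (M m : ℕ → ℕ) [∀ n, NeZero (M n)]
    (hM : Tendsto M atTop atTop) (hm : ∀ n, m n ≤ M n)
    (hmβ : Tendsto (fun n => (m n : ℝ) / (M n : ℝ) ^ β) atTop (𝓝 1)) :
    (max (1 / 2) β < θ → Tendsto
      (fun n => rescaled (pureLaw (M n) (M n + m n)) (M n + m n) θ) atTop (𝓝 pointMass)) ∧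
    (θ = 1 / 2 → β < 1 / 2 → Tendsto
      (fun n => rescaled (pureLaw (M n) (M n + m n)) (M n + m n) θ) atTop (𝓝 stdNormal)) ∧
    (θ = 1 / 2 → β = 1 / 2 → Tendsto
      (fun n => rescaled (pureLaw (M n) (M n + m n)) (M n + m n) θ)
      atTop (𝓝 (indepSum stdNormal (arcsineLaw 0)))) ∧
    (θ = β → 1 / 2 < β → β < 1 → Tendsto
      (fun n => rescaled (pureLaw (M n) (M n + m n)) (M n + m n) θ)
      atTop (𝓝 (arcsineLaw 0))) ∧
    (θ = 1 → β = 1 → Tendsto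
      (fun n => rescaled (pureLaw (M n) (M n + m n)) (M n + m n) θ)
      atTop (𝓝 (arcsineLaw 1))) := by
  have hx : Tendsto (fun n => (M n : ℝ)) atTop atTop := tendsto_natCast_atTop_atTop.comp hM
  have hp : ∀ n v, _ = _ := fun n v => latticeCharFun_pureLaw (hm n) v
  -- For `β < 1` one has `m = o(M)`, so `t ~ M`; for `β = 1`, `t ~ 2M`, which is why the arcsine
  -- parameter jumps from `0` to `1`.
  rcases hβ.lt_or_eq with hlt | rfl
  · have hl := tendsto_div_of_lt_one hM hmβ hlt
    have ha := tendsto_sub_div hM hm hl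
    have ht := tendsto_add_div hM hl
    rw [sub_zero] at ha
    rw [add_zero] at ht
    refine ⟨tendsto_pointMass_of_symQubit hp hx one_pos ht ha hmβ,
      fun h1 h2 => tendsto_stdNormal_of_symQubit hp hx one_pos ht ha hmβ h1 h2 rfl,
      fun h1 h2 => tendsto_indepSum_of_symQubit hp hx one_pos ht ha hmβ h1 h2 rfl (by simp),
      fun h1 h2 _ => tendsto_arcsineLaw_of_symQubit hp hx one_pos ht ha hmβ h1 h2 (by simp),
      fun _ h => absurd h hlt.ne⟩
  · have hl : Tendsto (fun n => (m n : ℝ) / (M n : ℝ)) atTop (𝓝 1) := by simpa using hmβ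
    have ha := tendsto_sub_div hM hm hl
    have ht := tendsto_add_div hM hl
    refine ⟨fun h => ?_, fun _ h => ?_, fun _ h => ?_, fun _ _ h => absurd h (lt_irrefl _),
      fun h1 _ => tendsto_arcsineLaw_of_symQubit hp hx (by norm_num) ht ha hmβ h1 (by norm_num)
        (by rw [one_add_one_eq_two, Real.rpow_neg zero_le_two])⟩
    · exact absurd ((le_max_right _ _).trans_lt h) hθ.not_gt
    · norm_num at h
    · norm_num at h

theorem mixedLaw_limits {β θ : ℝ} (hβ : β ≤ 1) (M m : ℕ → ℕ) [∀ n, NeZero (M n)]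
    (hM : Tendsto M atTop atTop) (hm : ∀ n, m n ≤ M n)
    (hmβ : Tendsto (fun n => (m n : ℝ) / (M n : ℝ) ^ β) atTop (𝓝 1)) :
    (max (1 / 2) β < θ → Tendsto
      (fun n => rescaled (mixedLaw (M n) (m n) (2 * M n)) (2 * M n) θ)
      atTop (𝓝 pointMass)) ∧
    (θ = 1 / 2 → β < 1 / 2 → Tendsto
      (fun n => rescaled (mixedLaw (M n) (m n) (2 * M n)) (2 * M n) θ)
      atTop (𝓝 stdNormal)) ∧
    (θ = 1 / 2 → β = 1 / 2 → Tendsto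
      (fun n => rescaled (mixedLaw (M n) (m n) (2 * M n)) (2 * M n) θ)
      atTop (𝓝 (indepSum stdNormal (arcsineLaw (1 / 2))))) ∧
    (θ = β → 1 / 2 < β → Tendsto
      (fun n => rescaled (mixedLaw (M n) (m n) (2 * M n)) (2 * M n) θ)
      atTop (𝓝 (arcsineLaw β))) := by
  have hx : Tendsto (fun n => (M n : ℝ)) atTop atTop := tendsto_natCast_atTop_atTop.comp hM
  have hp : ∀ n v, _ = _ := fun n v => latticeCharFun_mixedLaw (hm n) v
  have hdouble : ∀ {f : ℕ → ℕ} {l : ℝ}, Tendsto (fun n => (f n : ℝ) / (M n : ℝ)) atTop (𝓝 l) →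
      Tendsto (fun n => ((2 * f n : ℕ) : ℝ) / (M n : ℝ)) atTop (𝓝 (2 * l)) := by
    intro f l h
    refine (h.const_mul 2).congr fun n => ?_
    push_cast
    ring
  have ht := hdouble (tendsto_div_self_one hx)
  rw [mul_one] at ht
  have hlim : ∃ l : ℝ, Tendsto (fun n => (m n : ℝ) / (M n : ℝ)) atTop (𝓝 l) ∧ (β < 1 → l = 0) := by
    rcases hβ.lt_or_eq with hlt | rfl
    · exact ⟨0, tendsto_div_of_lt_one hM hmβ hlt, fun _ => rfl⟩
    · exact ⟨1, by simpa using hmβ, fun h => absurd h (lt_irrefl _)⟩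
  obtain ⟨l, hl, hl0⟩ := hlim
  have ha := hdouble (tendsto_sub_div hM hm hl)
  have hc : β < 1 → 2 * (1 - l) = 2 := fun h => by rw [hl0 h]; ring
  have hb : ∀ b : ℝ, (2 : ℝ) ^ (-b) = ((2 : ℝ) ^ b)⁻¹ := Real.rpow_neg zero_le_two
  exact ⟨tendsto_pointMass_of_symQubit hp hx two_pos ht ha hmβ,
    fun h1 h2 => tendsto_stdNormal_of_symQubit hp hx two_pos ht ha hmβ h1 h2 (hc (by linarith)),
    fun h1 h2 => tendsto_indepSum_of_symQubit hp hx two_pos ht ha hmβ h1 h2 (hc (by linarith))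
      (hb _),
    fun h1 h2 => tendsto_arcsineLaw_of_symQubit hp hx two_pos ht ha hmβ h1 h2 (hb _)⟩

/-! ### Limits for a fully random initial qubit -/

section RandomQubit

variable {t M : ℕ → ℕ} {β θ : ℝ} [∀ n, NeZero (M n)]

theorem eventually_eq_one {f : ℕ → ℕ} (h : Tendsto (fun n => (f n : ℝ)) atTop (𝓝 1)) :
    ∀ᶠ n in atTop, f n = 1 := by
  filter_upwards [h.eventually (Ioo_mem_nhds (a := 1 / 2) (b := 2) (by norm_num) (by norm_num))]
    with n hn
  have h1 : 0 < f n := by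
    have : (0 : ℝ) < f n := by linarith [hn.1]
    exact_mod_cast this
  have h2 : f n < 2 := by exact_mod_cast hn.2
  omega

theorem tendsto_stdNormal_of_randomQubit (ht : Tendsto t atTop atTop)
    (hd : Tendsto (fun n => ((t n / M n : ℕ) : ℝ)) atTop (𝓝 1)) :
    Tendsto (fun n => rescaled (randomLaw (M n) (t n)) (t n) (1 / 2)) atTop (𝓝 stdNormal) := by
  have hx : Tendsto (fun n => (t n : ℝ)) atTop atTop := tendsto_natCast_atTop_atTop.comp ht
  refine tendsto_rescaled fun u => ?_
  rw [charFun_stdNormal]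
  have hs : Tendsto (fun n => (t n : ℝ) * (u / (t n : ℝ) ^ (1 / 2 : ℝ)) ^ 2) atTop
      (𝓝 (u ^ 2)) := by
    refine Tendsto.congr' ?_ tendsto_const_nhds
    filter_upwards [hx.eventually_gt_atTop 0] with n hn
    rw [div_pow, ← rpow_two_mul hn.le, mul_one_div_cancel two_ne_zero, Real.rpow_one]
    field_simp
  refine (tendsto_cos_pow (tendsto_const_div_rpow u hx (by norm_num)) hs).congr' ?_
  filter_upwards [eventually_eq_one hd] with n hn
  rw [latticeCharFun_randomLaw_of_div_eq_one hn]

/-- Allows replacing the number of coins although the `NeZero` instance depends on it. -/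
theorem randomLaw_congr {M N : ℕ} [NeZero M] [NeZero N] (h : M = N) (t : ℕ) :
    randomLaw M t = randomLaw N t := by
  subst h
  rfl

theorem tendsto_konnoLaw_of_randomQubit (ht : Tendsto t atTop atTop)
    (hM : Tendsto (fun n => (M n : ℝ)) atTop (𝓝 1)) :
    Tendsto (fun n => rescaled (randomLaw (M n) (t n)) (t n) 1) atTop (𝓝 konnoLaw) := by
  have hx : Tendsto (fun n => (t n : ℝ)) atTop atTop := tendsto_natCast_atTop_atTop.comp ht
  refine tendsto_rescaled fun u => ?_
  rw [← mean_eq_charFun_konnoLaw]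
  have hs : Tendsto (fun n => (t n : ℝ) * (u / (t n : ℝ) ^ (1 : ℝ))) atTop (𝓝 u) := by
    refine Tendsto.congr' ?_ tendsto_const_nhds
    filter_upwards [hx.eventually_gt_atTop 0] with n hn
    rw [Real.rpow_one]
    field_simp
  refine (tendsto_latticeCharFun_randomLaw_one (tendsto_const_div_rpow u hx one_pos) hs).congr' ?_
  filter_upwards [eventually_eq_one hM] with n hn
  rw [randomLaw_congr hn]

/-- The governing quantity is `M d² ~ t^(1+β)`, to be compared with `t^(2θ)`. The limit `c` for `d +
1` is kept separate because it is `2`, not `1`, when `β = 0`; `hL` asks that this not affect the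
result. -/
theorem tendsto_latticeCharFun_randomLaw_rpow {L c : ℝ} (hβ : 0 ≤ β) (ht : Tendsto t atTop atTop)
    (hM : Tendsto (fun n => (M n : ℝ) / (t n : ℝ) ^ (1 - β)) atTop (𝓝 1))
    (hd : Tendsto (fun n => ((t n / M n : ℕ) : ℝ) / (t n : ℝ) ^ β) atTop (𝓝 1))
    (hd1 : Tendsto (fun n => ((t n / M n + 1 : ℕ) : ℝ) / (t n : ℝ) ^ β) atTop (𝓝 c))
    (hβθ : β < θ) (hβθ' : 1 - β < 2 * θ)
    (hL : ∀ f : ℕ → ℝ, ∀ b, b = 1 ∨ b = c →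
      Tendsto (fun n => f n / (t n : ℝ) ^ (1 + β)) atTop (𝓝 (b ^ 2)) →
      Tendsto (fun n => f n / (t n : ℝ) ^ (2 * θ)) atTop (𝓝 (L ^ 2))) (u : ℝ) :
    Tendsto (fun n => latticeCharFun (randomLaw (M n) (t n)) (u / (t n : ℝ) ^ θ)) atTop
      (𝓝 (((2 * Real.pi)⁻¹ : ℝ) * ∫ k in (-Real.pi)..Real.pi,
        Complex.exp (-((u * L * groupVelocity k) ^ 2 / 2 : ℝ)))) := by
  have hx : Tendsto (fun n => (t n : ℝ)) atTop atTop := tendsto_natCast_atTop_atTop.comp ht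
  have hself := tendsto_div_self_one hx
  have key : ∀ (e : ℕ → ℕ) (b : ℝ), b = 1 ∨ b = c →
      Tendsto (fun n => (e n : ℝ) / (t n : ℝ) ^ β) atTop (𝓝 b) →
      Tendsto (fun n => (M n : ℝ) * ((e n : ℝ) * (u / (t n : ℝ) ^ θ)) ^ 2) atTop
        (𝓝 ((u * L) ^ 2)) := by
    intro e b hb he
    have h1 : Tendsto (fun n => (M n : ℝ) * (e n : ℝ) ^ 2 / (t n : ℝ) ^ (1 + β)) atTop
        (𝓝 (b ^ 2)) := by
      have h2 := hM.mul (he.pow 2)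
      rw [one_mul] at h2
      refine h2.congr' ?_
      filter_upwards [hx.eventually_gt_atTop 0] with n hn
      rw [show 1 + β = (1 - β) + 2 * β by ring, Real.rpow_add hn, rpow_two_mul hn.le, div_pow]
      field_simp
    have h3 := (hL _ b hb h1).const_mul (u ^ 2)
    rw [← mul_pow] at h3
    refine h3.congr fun n => ?_
    rw [rpow_two_mul (Nat.cast_nonneg _)]
    ring
  refine tendsto_latticeCharFun_randomLaw (L := u * L)
    (tendsto_const_div_rpow u hx (hβ.trans_lt hβθ)) ?_ ?_ (key _ 1 (Or.inl rfl) hd)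
    (key _ c (Or.inr rfl) hd1)
  · have h1 := (tendsto_div_rpow_of_lt hx hself one_pos hM hβθ').const_mul (u ^ 2)
    rw [mul_zero] at h1
    refine h1.congr fun n => ?_
    rw [rpow_two_mul (Nat.cast_nonneg _)]
    ring
  · have h1 := (tendsto_div_rpow_of_lt hx hself one_pos hd hβθ).const_mul u
    rw [mul_zero] at h1
    exact h1.congr fun n => by ring

theorem tendsto_succ_div_rpow {d t : ℕ → ℕ} (hβ : 0 < β) (ht : Tendsto t atTop atTop)
    (hd : Tendsto (fun n => (d n : ℝ) / (t n : ℝ) ^ β) atTop (𝓝 1)) :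
    Tendsto (fun n => ((d n + 1 : ℕ) : ℝ) / (t n : ℝ) ^ β) atTop (𝓝 1) := by
  have hx : Tendsto (fun n => (t n : ℝ)) atTop atTop := tendsto_natCast_atTop_atTop.comp ht
  have h := hd.add (tendsto_const_div_rpow 1 hx hβ)
  rw [add_zero] at h
  refine h.congr fun n => ?_
  push_cast
  ring

theorem tendsto_pointMass_of_randomQubit (hβ : 0 ≤ β) (hθ : θ ≤ 1) (ht : Tendsto t atTop atTop)
    (hM : Tendsto (fun n => (M n : ℝ) / (t n : ℝ) ^ (1 - β)) atTop (𝓝 1))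
    (hd : Tendsto (fun n => ((t n / M n : ℕ) : ℝ) / (t n : ℝ) ^ β) atTop (𝓝 1))
    (h : (1 + β) / 2 < θ) :
    Tendsto (fun n => rescaled (randomLaw (M n) (t n)) (t n) θ) atTop (𝓝 pointMass) := by
  have hx : Tendsto (fun n => (t n : ℝ)) atTop atTop := tendsto_natCast_atTop_atTop.comp ht
  have hd1 : ∃ c, Tendsto (fun n => ((t n / M n + 1 : ℕ) : ℝ) / (t n : ℝ) ^ β) atTop (𝓝 c) := by
    rcases hβ.eq_or_lt with rfl | hpos
    · refine ⟨1 + 1, (hd.add_const 1).congr fun n => ?_⟩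
      push_cast
      simp
    · exact ⟨1, tendsto_succ_div_rpow hpos ht hd⟩
  obtain ⟨c, hd1⟩ := hd1
  refine tendsto_rescaled fun u => ?_
  -- Here `θ ≤ 1` forces `β < 1`, hence `β < (1 + β)/2 < θ`. With `L = 0` the value of `c` is
  -- immaterial.
  have h1 := tendsto_latticeCharFun_randomLaw_rpow (L := 0) (θ := θ) hβ ht hM hd hd1
    (by linarith) (by linarith) (fun f b _ hf => by
      rw [zero_pow two_ne_zero]
      exact tendsto_div_rpow_of_lt hx (tendsto_div_self_one hx) one_pos hf (by linarith)) u
  rw [charFun_pointMass]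
  convert h1 using 2
  have := mean_zero_eq_one
  simpa using this.symm

theorem tendsto_normal_mul_konno_of_randomQubit (hβ : 0 < β) (hβ1 : β < 1)
    (ht : Tendsto t atTop atTop)
    (hM : Tendsto (fun n => (M n : ℝ) / (t n : ℝ) ^ (1 - β)) atTop (𝓝 1))
    (hd : Tendsto (fun n => ((t n / M n : ℕ) : ℝ) / (t n : ℝ) ^ β) atTop (𝓝 1))
    (h : θ = (1 + β) / 2) :
    Tendsto (fun n => rescaled (randomLaw (M n) (t n)) (t n) θ) atTop
      (𝓝 (indepMul stdNormal konnoLaw)) := by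
  refine tendsto_rescaled fun u => ?_
  have h1 := tendsto_latticeCharFun_randomLaw_rpow (L := 1) (θ := θ) hβ.le ht hM hd
    (tendsto_succ_div_rpow hβ ht hd) (by linarith) (by linarith) (fun f b hb hf => by
      rw [show 2 * θ = 1 + β by linarith]
      rwa [show b = 1 by tauto] at hf) u
  rw [← mean_eq_charFun_normal_mul_konno]
  simpa only [mul_one] using h1

end RandomQubit

end ManyCoins

end

theorem theorem1 (β θ : ℝ) (hβ : β ∈ Set.Icc (0 : ℝ) 1) (hθ : θ ∈ Set.Icc (0 : ℝ) 1) :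
    -- (a): `t = M + m` with `m ∼ M^β`, initial qubit `φ₀^{⊗ M}`, `M → ∞`
    (∀ (M m : ℕ → ℕ) [∀ n, NeZero (M n)],
      Tendsto M atTop atTop → (∀ n, m n ≤ M n) →
      Tendsto (fun n => (m n : ℝ) / (M n : ℝ) ^ β) atTop (𝓝 1) →
      (max (1 / 2) β < θ → Tendsto
        (fun n => ManyCoins.rescaled (ManyCoins.pureLaw (M n) (M n + m n)) (M n + m n) θ)
        atTop (𝓝 ManyCoins.pointMass)) ∧
      (θ = 1 / 2 → β < 1 / 2 → Tendsto
        (fun n => ManyCoins.rescaled (ManyCoins.pureLaw (M n) (M n + m n)) (M n + m n) θ)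
        atTop (𝓝 ManyCoins.stdNormal)) ∧
      (θ = 1 / 2 → β = 1 / 2 → Tendsto
        (fun n => ManyCoins.rescaled (ManyCoins.pureLaw (M n) (M n + m n)) (M n + m n) θ)
        atTop (𝓝 (ManyCoins.indepSum ManyCoins.stdNormal (ManyCoins.arcsineLaw 0)))) ∧
      (θ = β → 1 / 2 < β → β < 1 → Tendsto
        (fun n => ManyCoins.rescaled (ManyCoins.pureLaw (M n) (M n + m n)) (M n + m n) θ)
        atTop (𝓝 (ManyCoins.arcsineLaw 0))) ∧
      (θ = 1 → β = 1 → Tendsto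
        (fun n => ManyCoins.rescaled (ManyCoins.pureLaw (M n) (M n + m n)) (M n + m n) θ)
        atTop (𝓝 (ManyCoins.arcsineLaw 1)))) ∧
    -- (b): `t = 2 M`, initial qubit `φ₀^{⊗ m} ⊗ φ_1 ⊗ ⋯ ⊗ φ_{M-m}` with `m ∼ M^β`, `M → ∞`
    (∀ (M m : ℕ → ℕ) [∀ n, NeZero (M n)],
      Tendsto M atTop atTop → (∀ n, m n ≤ M n) →
      Tendsto (fun n => (m n : ℝ) / (M n : ℝ) ^ β) atTop (𝓝 1) →
      (max (1 / 2) β < θ → Tendsto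
        (fun n => ManyCoins.rescaled (ManyCoins.mixedLaw (M n) (m n) (2 * M n)) (2 * M n) θ)
        atTop (𝓝 ManyCoins.pointMass)) ∧
      (θ = 1 / 2 → β < 1 / 2 → Tendsto
        (fun n => ManyCoins.rescaled (ManyCoins.mixedLaw (M n) (m n) (2 * M n)) (2 * M n) θ)
        atTop (𝓝 ManyCoins.stdNormal)) ∧
      (θ = 1 / 2 → β = 1 / 2 → Tendsto
        (fun n => ManyCoins.rescaled (ManyCoins.mixedLaw (M n) (m n) (2 * M n)) (2 * M n) θ)
        atTop (𝓝 (ManyCoins.indepSum ManyCoins.stdNormal (ManyCoins.arcsineLaw (1 / 2))))) ∧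
      (θ = β → 1 / 2 < β → Tendsto
        (fun n => ManyCoins.rescaled (ManyCoins.mixedLaw (M n) (m n) (2 * M n)) (2 * M n) θ)
        atTop (𝓝 (ManyCoins.arcsineLaw β)))) ∧
    -- (c): `M ∼ t^{1-β}` and `d = ⌊t / M⌋ ∼ t^β`, random initial qubit, `t → ∞`
    (∀ (t M : ℕ → ℕ) [∀ n, NeZero (M n)],
      Tendsto t atTop atTop →
      Tendsto (fun n => (M n : ℝ) / (t n : ℝ) ^ (1 - β)) atTop (𝓝 1) →
      Tendsto (fun n => ((t n / M n : ℕ) : ℝ) / (t n : ℝ) ^ β) atTop (𝓝 1) →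
      ((1 + β) / 2 < θ → Tendsto
        (fun n => ManyCoins.rescaled (ManyCoins.randomLaw (M n) (t n)) (t n) θ)
        atTop (𝓝 ManyCoins.pointMass)) ∧
      (θ = 1 / 2 → β = 0 → Tendsto
        (fun n => ManyCoins.rescaled (ManyCoins.randomLaw (M n) (t n)) (t n) θ)
        atTop (𝓝 ManyCoins.stdNormal)) ∧
      (θ = (1 + β) / 2 → 0 < β → β < 1 → Tendsto
        (fun n => ManyCoins.rescaled (ManyCoins.randomLaw (M n) (t n)) (t n) θ)
        atTop (𝓝 (ManyCoins.indepMul ManyCoins.stdNormal ManyCoins.konnoLaw))) ∧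
      (θ = 1 → β = 1 → Tendsto
        (fun n => ManyCoins.rescaled (ManyCoins.randomLaw (M n) (t n)) (t n) θ)
        atTop (𝓝 ManyCoins.konnoLaw))) := by
  obtain ⟨hβ0, hβ1⟩ := hβ
  refine ⟨fun M m _ hM hm hmβ => ManyCoins.pureLaw_limits hβ1 hθ.2 M m hM hm hmβ,
    fun M m _ hM hm hmβ => ManyCoins.mixedLaw_limits hβ1 M m hM hm hmβ,
    fun t M _ ht hM hd => ⟨ManyCoins.tendsto_pointMass_of_randomQubit hβ0 hθ.2 ht hM hd,
      fun h1 h2 => ?_,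
      fun h1 h2 h3 => ManyCoins.tendsto_normal_mul_konno_of_randomQubit h2 h3 ht hM hd h1,
      fun h1 h2 => ?_⟩⟩
  · subst h1 h2
    exact ManyCoins.tendsto_stdNormal_of_randomQubit ht (by simpa using hd)
  · subst h1 h2
    exact ManyCoins.tendsto_konnoLaw_of_randomQubit ht (by simpa using hM)
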